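/- **Conventions.** Let $\mathbb{K}$ be a field of characteristic zero. A (nonsymmetric) operad is a graded vector space $\mathcal{O}=\bigoplus_{n\ge 1}\mathcal{O}(n)$ with a unit $\mathbb{1}\in\mathcal{O}(1)$ and bilinear partial compositions $\circ_i:\mathcal{O}(n)\times\mathcal{O}(m)\to\mathcal{O}(n+m-1)$, $1\le i\le n$, satisfying the usual sequential associativity, parallel associativity and unit axioms. Let $\mathcal{M}$ be a finite unitary magma, that is, a finite set with a binary operation $\star$ having a two-sided unit $1_\mathcal{M}$ (no associativity is assumed). An *$\mathcal{M}$-clique* of arity $n\ge 1$ is a map $\mathfrak{p}$ assigning a label $\mathfrak{p}(x,y)\in\mathcal{M}$ to each arc $(x,y)$, $1\le x<y\le n+1$; for $n=1$ only the label $\mathfrak p(1,2)=1_\mathcal{M}$ is allowed. Write $\mathfrak{p}_0:=\mathfrak{p}(1,n+1)$ (the base) and $\mathfrak{p}_i:=\mathfrak{p}(i,i+1)$ (the $i$th edge); the other arcs are the diagonals. An arc is solid if its label is not $1_\mathcal{M}$, and two diagonals $(x,y)$, $(x',y')$ cross if $x<x'<y<y'$ or $x'<x<y'<y$. The clique $\mathfrak{p}$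 is *noncrossing* if no two solid diagonals of $\mathfrak{p}$ cross. The operad $\mathsf{C}\mathcal{M}$ has the $\mathcal{M}$-cliques of arity $n$ as a basis of its component of arity $n$; for cliques $\mathfrak{p},\mathfrak{q}$ of arities $n,m$, the clique $\mathfrak{p}\circ_i\mathfrak{q}$ of arity $n+m-1$ is obtained by gluing the base of $\mathfrak{q}$ onto the $i$th edge of $\mathfrak{p}$, the arc $(i,i+m)$ resulting from the two glued arcs being labeled by $\mathfrak{p}_i\star\mathfrak{q}_0$, the other arcs of $\mathfrak{p}$ and $\mathfrak{q}$ keeping their labels, and all the remaining arcs being labeled by $1_\mathcal{M}$. Let $\mathrm{NC}\mathcal{M}$ be the suboperad of $\mathsf{C}\mathcal{M}$ spanned by the noncrossing $\mathcal{M}$-cliques. Let $\mathcal{T}_\mathcal{M}$ be the set of all $\mathcal{M}$-triangles, i.e., of all $\mathcal{M}$-cliques of arity $2$, and denote by $(a;b,c)$ the triangle with base $a$, first edge $b$ and second edge $c$. Let $\mathrm{Free}(\mathrm{Vect}(\mathcal{T}_\mathcal{M}))$ be the free operad on $\mathcal{T}_\mathcal{M}$ (in arity $2$): its basis consists of the syntax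 trees, that is, the planar binary trees whose internal nodes are labeled by $\mathcal{T}_\mathcal{M}$, the arity being the number of leaves, and $\circ_i$ grafts a tree on the $i$th leaf. Identify a triangle with the corolla it labels. Let $\mathfrak{R}_{\mathrm{NC}\mathcal{M}}$ be the subspace of $\mathrm{Free}(\mathrm{Vect}(\mathcal{T}_\mathcal{M}))(3)$ spanned by the following elements, for all labels in $\mathcal{M}$: 1. $(p_0;p_1,p_2)\circ_1(q_0;q_1,q_2)-(p_0;r_1,p_2)\circ_1(r_0;q_1,q_2)$ if $p_1\star q_0=r_1\star r_0\ne 1_\mathcal{M}$; 2. $(p_0;p_1,p_2)\circ_1(q_0;q_1,q_2)-(p_0;q_1,r_2)\circ_2(r_0;q_2,p_2)$ if $p_1\star q_0=r_2\star r_0=1_\mathcal{M}$; 3. $(p_0;p_1,p_2)\circ_2(q_0;q_1,q_2)-(p_0;p_1,r_2)\circ_2(r_0;q_1,q_2)$ if $p_2\star q_0=r_2\star r_0\ne 1_\mathcal{M}$. Let $\to$ be the rewrite rule on syntax trees given by - $(p_0;p_1,p_2)\circ_1(q_0;q_1,q_2)\to(p_0;p_1\star q_0,p_2)\circ_1(1_\mathcal{M};q_1,q_2)$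 if $q_0\ne 1_\mathcal{M}$; - $(p_0;p_1,p_2)\circ_1(q_0;q_1,q_2)\to(p_0;q_1,1_\mathcal{M})\circ_2(1_\mathcal{M};q_2,p_2)$ if $p_1\star q_0=1_\mathcal{M}$; - $(p_0;p_1,p_2)\circ_2(q_0;q_1,q_2)\to(p_0;p_1,p_2\star q_0)\circ_2(1_\mathcal{M};q_1,q_2)$ if $q_0\ne 1_\mathcal{M}$. A tree is rewritten in one step by replacing inside it an occurrence of the left member $\mathfrak{s}$ of a rule $\mathfrak{s}\to\mathfrak{s}'$ by $\mathfrak{s}'$. A normal form is a tree that cannot be rewritten; the rule is convergent if there is no infinite chain of one-step rewritings and one-step rewriting is confluent. **Theorem.** Let $\mathcal{M}$ be a finite unitary magma. (a) $\mathrm{NC}\mathcal{M}$ is the suboperad of $\mathsf{C}\mathcal{M}$ generated by the set $\mathcal{T}_\mathcal{M}$ of the $\mathcal{M}$-triangles. (b) $\mathrm{NC}\mathcal{M}$ admits the presentation $(\mathcal{T}_\mathcal{M},\mathfrak{R}_{\mathrm{NC}\mathcal{M}})$, which is binary (the generators have arity $2$) and quadratic (the relations are combinations of trees with two internal nodes):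 there is an operad isomorphism $$\mathrm{Free}(\mathrm{Vect}(\mathcal{T}_\mathcal{M}))/\langle\mathfrak{R}_{\mathrm{NC}\mathcal{M}}\rangle\;\simeq\;\mathrm{NC}\mathcal{M},$$ where $\langle\mathfrak{R}_{\mathrm{NC}\mathcal{M}}\rangle$ is the operad ideal generated by $\mathfrak{R}_{\mathrm{NC}\mathcal{M}}$, sending the class of the corolla labeled by each $\mathcal{M}$-triangle to this triangle. (c) The rewrite rule $\to$ is a convergent orientation of $\mathfrak{R}_{\mathrm{NC}\mathcal{M}}$: the space spanned by the differences $\mathfrak{t}-\mathfrak{t}'$ of syntax trees related by the reflexive, symmetric and transitive closure of $\to$ is $\mathfrak{R}_{\mathrm{NC}\mathcal{M}}$, and $\to$ is convergent. Each space $\mathrm{NC}\mathcal{M}(n)$ is finite-dimensional, there are finitely many normal forms of $\to$ of each arity, and the generating series of the normal forms (by arity) is the Hilbert series $\sum_{n\ge 1}\dim\mathrm{NC}\mathcal{M}(n)\,t^n$ of $\mathrm{NC}\mathcal{M}$. -/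

import Mathlib

universe u v w

/-! ## Nonsymmetric operads

Throughout, an operad is stored with its arities shifted by one: `obj n` is the component of
arity `n + 1`, and `comp i` with `i : Fin (n + 1)` is the partial composition at the input
number `i + 1`. In particular the partial composition of elements of arities `n + 1` and
`m + 1` has arity `(n + 1) + (m + 1) - 1 = (n + m) + 1`. -/

/-- Transport of an element of a graded object along an equality of degrees. -/
def arityCast {O : ℕ → Type u} {a b : ℕ} (h : a = b) (x : O a) : O b := h ▸ x

/-- Nonsymmetric operads in `K`-vector spaces, presented by partial compositions. -/
structure NSOperad (K : Type u) [Field K] where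
  obj : ℕ → Type w
  [addCommGroup : ∀ n, AddCommGroup (obj n)]
  [module : ∀ n, Module K (obj n)]
  one : obj 0
  comp : ∀ {n m : ℕ}, Fin (n + 1) → (obj n →ₗ[K] obj m →ₗ[K] obj (n + m))
  comp_assoc : ∀ {n m k : ℕ} (x : obj n) (y : obj m) (z : obj k) (i : Fin (n + 1))
    (j : Fin (m + 1)),
    arityCast (Nat.add_assoc n m k)
      (comp (⟨i + j, by omega⟩ : Fin (n + m + 1)) (comp i x y) z) = comp i x (comp j y z)
  comp_comm : ∀ {n m k : ℕ} (x : obj n) (y : obj m) (z : obj k) (i j : Fin (n + 1)), i < j →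
    arityCast (Nat.add_right_comm n m k)
      (comp (⟨j + m, by omega⟩ : Fin (n + m + 1)) (comp i x y) z) =
        comp (⟨i, by omega⟩ : Fin (n + k + 1)) (comp j x z) y
  one_comp : ∀ {n : ℕ} (x : obj n), arityCast (Nat.zero_add n) (comp 0 one x) = x
  comp_one : ∀ {n : ℕ} (x : obj n) (i : Fin (n + 1)), comp i x one = x

namespace NSOperad

attribute [instance] NSOperad.addCommGroup NSOperad.module

variable {K : Type u} [Field K]

/-- Operad isomorphisms. -/
structure Iso (O : NSOperad.{u, v} K) (P : NSOperad.{u, w} K) where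
  toEquiv : ∀ n, O.obj n ≃ₗ[K] P.obj n
  map_one : toEquiv 0 O.one = P.one
  map_comp : ∀ {n m : ℕ} (i : Fin (n + 1)) (x : O.obj n) (y : O.obj m),
    toEquiv (n + m) (O.comp i x y) = P.comp i (toEquiv n x) (toEquiv m y)

/-- The Hilbert series `∑_{n ≥ 1} dim O(n) tⁿ`. -/
noncomputable def hilbertSeries (O : NSOperad.{u, w} K) : PowerSeries ℕ :=
  PowerSeries.mk fun n => if n = 0 then 0 else Module.finrank K (O.obj (n - 1))

/-- Suboperads: graded subspaces containing the unit and closed under partial compositions. -/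
@[ext]
structure Suboperad (O : NSOperad.{u, w} K) where
  carrier : ∀ n, Submodule K (O.obj n)
  one_mem : O.one ∈ carrier 0
  comp_mem : ∀ {n m : ℕ} (i : Fin (n + 1)) {x : O.obj n} {y : O.obj m},
    x ∈ carrier n → y ∈ carrier m → O.comp i x y ∈ carrier (n + m)

/-- The suboperad generated by a graded set: the smallest suboperad containing it. -/
def Suboperad.generated (O : NSOperad.{u, w} K) (G : ∀ n, Set (O.obj n)) : O.Suboperad where
  carrier n := ⨅ P : {P : O.Suboperad // ∀ n, G n ⊆ P.carrier n}, P.1.carrier n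
  one_mem := by
    simp only [Submodule.mem_iInf]
    exact fun P => P.1.one_mem
  comp_mem := by
    intro n m i x y hx hy
    simp only [Submodule.mem_iInf] at hx hy ⊢
    exact fun P => P.1.comp_mem i (hx P) (hy P)

theorem arityCast_const {A : Type w} {a b : ℕ} (h : a = b) (x : A) :
    arityCast (O := fun _ => A) h x = x := by
  subst h; rfl

theorem arityCast_subtype {O : ℕ → Type w} (p : ∀ n, O n → Prop) {a b : ℕ} (h : a = b)
    (x : {y : O a // p a y}) :
    (arityCast (O := fun n => {y : O n // p n y}) h x).1 = arityCast h x.1 := by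
  subst h; rfl

/-- A suboperad, seen as an operad. -/
def Suboperad.toOperad {O : NSOperad.{u, w} K} (P : O.Suboperad) : NSOperad.{u, w} K where
  obj n := P.carrier n
  one := ⟨O.one, P.one_mem⟩
  comp {n m} i := LinearMap.mk₂ K
    (fun x y => (⟨O.comp i x.1 y.1, P.comp_mem i x.2 y.2⟩ : P.carrier (n + m)))
    (fun _ _ _ => Subtype.ext (by simp)) (fun _ _ _ => Subtype.ext (by simp))
    (fun _ _ _ => Subtype.ext (by simp)) (fun _ _ _ => Subtype.ext (by simp))
  comp_assoc x y z i j := Subtype.ext <|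
    (arityCast_subtype (fun n y => y ∈ P.carrier n) _ _).trans (O.comp_assoc x.1 y.1 z.1 i j)
  comp_comm x y z i j h := Subtype.ext <|
    (arityCast_subtype (fun n y => y ∈ P.carrier n) _ _).trans (O.comp_comm x.1 y.1 z.1 i j h)
  one_comp x := Subtype.ext <|
    (arityCast_subtype (fun n y => y ∈ P.carrier n) _ _).trans (O.one_comp x.1)
  comp_one x i := Subtype.ext (O.comp_one x.1 i)

/-- Operad ideals. -/
@[ext]
structure OperadIdeal (O : NSOperad.{u, w} K) where
  carrier : ∀ n, Submodule K (O.obj n)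
  comp_mem_left : ∀ {n m : ℕ} (i : Fin (n + 1)) (x : O.obj n) {y : O.obj m},
    y ∈ carrier m → O.comp i x y ∈ carrier (n + m)
  comp_mem_right : ∀ {n m : ℕ} (i : Fin (n + 1)) {x : O.obj n} (y : O.obj m),
    x ∈ carrier n → O.comp i x y ∈ carrier (n + m)

/-- The operad ideal generated by a graded subspace: the smallest ideal containing it. -/
def OperadIdeal.generated (O : NSOperad.{u, w} K) (R : ∀ n, Submodule K (O.obj n)) :
    O.OperadIdeal where
  carrier n := ⨅ I : {I : O.OperadIdeal // ∀ n, R n ≤ I.carrier n}, I.1.carrier n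
  comp_mem_left := by
    intro n m i x y hy
    simp only [Submodule.mem_iInf] at hy ⊢
    exact fun I => I.1.comp_mem_left i x (hy I)
  comp_mem_right := by
    intro n m i x y hx
    simp only [Submodule.mem_iInf] at hx ⊢
    exact fun I => I.1.comp_mem_right i y (hx I)

theorem arityCast_mk {O : NSOperad.{u, w} K} (I : O.OperadIdeal) {a b : ℕ} (h : a = b)
    (x : O.obj a) :
    arityCast (O := fun n => O.obj n ⧸ I.carrier n) h (Submodule.Quotient.mk x) =
      Submodule.Quotient.mk (arityCast h x) := by
  subst h; rfl

/-- The partial composition of a quotient operad. -/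
def OperadIdeal.quotientComp {O : NSOperad.{u, w} K} (I : O.OperadIdeal) {n m : ℕ}
    (i : Fin (n + 1)) : (O.obj n ⧸ I.carrier n) →ₗ[K] (O.obj m ⧸ I.carrier m) →ₗ[K]
      (O.obj (n + m) ⧸ I.carrier (n + m)) :=
  (I.carrier n).liftQ
    { toFun := fun x => (I.carrier m).mapQ (I.carrier (n + m)) (O.comp i x)
        fun _ hy => I.comp_mem_left i x hy
      map_add' := fun x x' => by
        apply Submodule.linearMap_qext
        ext y
        simp
      map_smul' := fun c x => by
        apply Submodule.linearMap_qext
        ext y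
        simp }
    (fun x hx => by
      rw [LinearMap.mem_ker]
      apply Submodule.linearMap_qext
      ext y
      simpa using I.comp_mem_right i y hx)

/-- The quotient operad `O / I`. -/
def OperadIdeal.quotient {O : NSOperad.{u, w} K} (I : O.OperadIdeal) : NSOperad.{u, w} K where
  obj n := O.obj n ⧸ I.carrier n
  one := Submodule.Quotient.mk O.one
  comp i := I.quotientComp i
  comp_assoc x y z i j := by
    induction x using Submodule.Quotient.induction_on with | _ x
    induction y using Submodule.Quotient.induction_on with | _ y
    induction z using Submodule.Quotient.induction_on with | _ z
    refine (arityCast_mk I _ _).trans ?_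
    rw [O.comp_assoc]
    rfl
  comp_comm x y z i j h := by
    induction x using Submodule.Quotient.induction_on with | _ x
    induction y using Submodule.Quotient.induction_on with | _ y
    induction z using Submodule.Quotient.induction_on with | _ z
    refine (arityCast_mk I _ _).trans ?_
    rw [O.comp_comm _ _ _ _ _ h]
    rfl
  one_comp x := by
    induction x using Submodule.Quotient.induction_on with | _ x
    refine (arityCast_mk I _ _).trans ?_
    rw [O.one_comp]
  comp_one x i := by
    induction x using Submodule.Quotient.induction_on with | _ x
    exact congrArg _ (O.comp_one x i)

/-- The canonical projection onto the quotient operad. -/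
def OperadIdeal.proj {O : NSOperad.{u, w} K} (I : O.OperadIdeal) (n : ℕ) :
    O.obj n →ₗ[K] I.quotient.obj n :=
  (I.carrier n).mkQ

end NSOperad

/-- Nonsymmetric operads in sets, with the same conventions on arities. -/
structure SetOperad where
  obj : ℕ → Type v
  one : obj 0
  comp : ∀ {n m : ℕ}, Fin (n + 1) → obj n → obj m → obj (n + m)
  comp_assoc : ∀ {n m k : ℕ} (x : obj n) (y : obj m) (z : obj k) (i : Fin (n + 1))
    (j : Fin (m + 1)),
    arityCast (Nat.add_assoc n m k)
      (comp (⟨i + j, by omega⟩ : Fin (n + m + 1)) (comp i x y) z) = comp i x (comp j y z)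
  comp_comm : ∀ {n m k : ℕ} (x : obj n) (y : obj m) (z : obj k) (i j : Fin (n + 1)), i < j →
    arityCast (Nat.add_right_comm n m k)
      (comp (⟨j + m, by omega⟩ : Fin (n + m + 1)) (comp i x y) z) =
        comp (⟨i, by omega⟩ : Fin (n + k + 1)) (comp j x z) y
  one_comp : ∀ {n : ℕ} (x : obj n), arityCast (Nat.zero_add n) (comp 0 one x) = x
  comp_one : ∀ {n : ℕ} (x : obj n) (i : Fin (n + 1)), comp i x one = x

namespace SetOperad

variable (K : Type u) [Field K]

/-- The bilinear extension of the partial composition. -/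
noncomputable def linComp (S : SetOperad.{v}) {n m : ℕ} (i : Fin (n + 1)) :
    (S.obj n →₀ K) →ₗ[K] (S.obj m →₀ K) →ₗ[K] (S.obj (n + m) →₀ K) :=
  Finsupp.linearCombination K fun x => Finsupp.lmapDomain K K (S.comp i x)

theorem linComp_single (S : SetOperad.{v}) {n m : ℕ} (i : Fin (n + 1)) (x : S.obj n)
    (y : S.obj m) (a b : K) :
    S.linComp K i (Finsupp.single x a) (Finsupp.single y b) =
      Finsupp.single (S.comp i x y) (a * b) := by
  simp [linComp, Finsupp.mapDomain_single]

/-- `arityCast` as a linear map, on the linear span of a graded set. -/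
noncomputable def linCast (S : SetOperad.{v}) {a b : ℕ} (h : a = b) :
    (S.obj a →₀ K) →ₗ[K] (S.obj b →₀ K) :=
  Finsupp.lmapDomain K K (arityCast h)

theorem arityCast_eq_linCast (S : SetOperad.{v}) {a b : ℕ} (h : a = b) (x : S.obj a →₀ K) :
    arityCast (O := fun n => S.obj n →₀ K) h x = S.linCast K h x := by
  subst h
  exact (Finsupp.mapDomain_id (v := x)).symm

theorem linCast_single (S : SetOperad.{v}) {a b : ℕ} (h : a = b) (x : S.obj a) (c : K) :
    S.linCast K h (Finsupp.single x c) = Finsupp.single (arityCast h x) c := by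
  simp [linCast, Finsupp.mapDomain_single]

/-- The linear span of a set-operad: `obj n` has the set `S.obj n` as a basis, and the partial
compositions are extended bilinearly. -/
noncomputable def linear (S : SetOperad.{v}) : NSOperad.{u, max u v} K where
  obj n := S.obj n →₀ K
  one := Finsupp.single S.one 1
  comp i := S.linComp K i
  comp_assoc x y z i j := by
    refine (S.arityCast_eq_linCast K _ _).trans ?_
    induction x using Finsupp.induction_linear with
    | zero => simp
    | add x x' hx hx' => simp only [map_add, LinearMap.add_apply, hx, hx']
    | single x a =>
    induction y using Finsupp.induction_linear with
    | zero => simp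
    | add y y' hy hy' => simp only [map_add, LinearMap.add_apply, hy, hy']
    | single y b =>
    induction z using Finsupp.induction_linear with
    | zero => simp
    | add z z' hz hz' => simp only [map_add, hz, hz']
    | single z c => simp only [linComp_single, linCast_single, S.comp_assoc, mul_assoc]
  comp_comm x y z i j h := by
    refine (S.arityCast_eq_linCast K _ _).trans ?_
    induction x using Finsupp.induction_linear with
    | zero => simp
    | add x x' hx hx' => simp only [map_add, LinearMap.add_apply, hx, hx']
    | single x a =>
    induction y using Finsupp.induction_linear with
    | zero => simp
    | add y y' hy hy' => simp only [map_add, LinearMap.add_apply, hy, hy']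
    | single y b =>
    induction z using Finsupp.induction_linear with
    | zero => simp
    | add z z' hz hz' => simp only [map_add, LinearMap.add_apply, hz, hz']
    | single z c =>
      simp only [linComp_single, linCast_single, S.comp_comm _ _ _ _ _ h, mul_right_comm]
  one_comp x := by
    refine (S.arityCast_eq_linCast K _ _).trans ?_
    induction x using Finsupp.induction_linear with
    | zero => simp
    | add x x' hx hx' => simp only [map_add, hx, hx']
    | single x a => simp only [linComp_single, linCast_single, S.one_comp, one_mul]
  comp_one x i := by
    induction x using Finsupp.induction_linear with
    | zero => simp
    | add x x' hx hx' => simp only [map_add, LinearMap.add_apply, hx, hx']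
    | single x a => simpa using (S.linComp_single K i x S.one a 1).trans (by simp [S.comp_one])

/-- The basis element of the linear span indexed by `x`. -/
noncomputable def basis (S : SetOperad.{v}) {n : ℕ} (x : S.obj n) : (S.linear K).obj n :=
  Finsupp.single x (1 : K)

end SetOperad

/-! ## Cliques decorated by a unitary magma

A unitary magma is a type `M` with `MulOneClass M`. Cliques follow the shifted convention:
`Clique M n` consists of the `M`-cliques of size (arity) `n + 1`, on the vertices
`1, …, n + 2`. -/

/-- The arcs of the clique of size `n + 1`. -/
def Arc (n : ℕ) : Type := {a : ℕ × ℕ // 1 ≤ a.1 ∧ a.1 < a.2 ∧ a.2 ≤ n + 2}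

/-- The `M`-cliques of size `n + 1`. The only one of size `1` has its base labeled by `1`. -/
@[ext]
structure Clique (M : Type v) [MulOneClass M] (n : ℕ) where
  label : Arc n → M
  label_of_size_one : n = 0 → ∀ a, label a = 1

namespace Clique

variable {M : Type v} [MulOneClass M] {n m k : ℕ}

/-- The label of the arc `(x, y)`; by convention `1` if `(x, y)` is not an arc. -/
def lab (p : Clique M n) (x y : ℕ) : M :=
  if h : 1 ≤ x ∧ x < y ∧ y ≤ n + 2 then p.label ⟨(x, y), h⟩ else 1

/-- The label of the arc `(x, y)` in the partial composition of `p` (of size `n + 1`) and `q`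
(of size `m + 1`), where the base of `q` is glued onto the `i`th edge of `p`, `1 ≤ i ≤ n + 1`. -/
def compLab (p : Clique M n) (i : ℕ) (q : Clique M m) (x y : ℕ) : M :=
  if y ≤ i then p.lab x y
  else if (x ≤ i ∧ i + (m + 1) ≤ y) ∧ ¬(x = i ∧ y = i + (m + 1)) then p.lab x (y - (m + 1) + 1)
  else if i + (m + 1) ≤ x then p.lab (x - (m + 1) + 1) (y - (m + 1) + 1)
  else if (i ≤ x ∧ x < y ∧ y ≤ i + (m + 1)) ∧ ¬(x = i ∧ y = i + (m + 1)) then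
    q.lab (x - i + 1) (y - i + 1)
  else if x = i ∧ y = i + (m + 1) then p.lab i (i + 1) * q.lab 1 (m + 2)
  else 1

theorem lab_size_one (p : Clique M 0) (x y : ℕ) : p.lab x y = 1 := by
  unfold lab; split_ifs
  · exact p.label_of_size_one rfl _
  · rfl

theorem lab_outside (p : Clique M n) {x y : ℕ} (h : ¬(1 ≤ x ∧ x < y ∧ y ≤ n + 2)) :
    p.lab x y = 1 := dif_neg h

theorem ext_lab {p q : Clique M n}
    (h : ∀ x y, 1 ≤ x → x < y → y ≤ n + 2 → p.lab x y = q.lab x y) : p = q := by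
  ext ⟨⟨x, y⟩, hxy⟩
  have := h x y hxy.1 hxy.2.1 hxy.2.2
  simpa [lab, dif_pos hxy] using this

/-- The partial composition of `M`-cliques. -/
def comp (i : Fin (n + 1)) (p : Clique M n) (q : Clique M m) : Clique M (n + m) where
  label a := compLab p (i + 1) q a.1.1 a.1.2
  label_of_size_one h a := by
    obtain ⟨rfl, rfl⟩ : n = 0 ∧ m = 0 := by omega
    simp [compLab, lab_size_one]

theorem lab_comp (i : Fin (n + 1)) (p : Clique M n) (q : Clique M m) (x y : ℕ)
    (h : 1 ≤ x ∧ x < y ∧ y ≤ n + m + 2) :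
    (comp i p q).lab x y = compLab p (i + 1) q x y := by
  rw [lab, dif_pos h]; rfl

theorem lab_arityCast {a b : ℕ} (h : a = b) (p : Clique M a) (x y : ℕ) :
    (arityCast h p : Clique M b).lab x y = p.lab x y := by
  subst h; rfl

/-- The `M`-clique of size `1`. -/
def one : Clique M 0 := ⟨fun _ => 1, fun _ _ => rfl⟩

theorem compLab_comp_left (i : Fin (n + 1)) (j : ℕ) (p : Clique M n) (q : Clique M m) (r : Clique M k)
    {x y : ℕ} (h1 : 1 ≤ x) (h2 : x < y) (h3 : y ≤ n + m + k + 2) (hj : 1 ≤ j) (hj' : j ≤ n + m + 1) :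
    compLab (comp i p q) j r x y = 
      if y ≤ j then compLab p (i+1) q x y
      else if (x ≤ j ∧ j + (k + 1) ≤ y) ∧ ¬(x = j ∧ y = j + (k + 1)) then compLab p (i+1) q x (y - k)
      else if j + (k + 1) ≤ x then compLab p (i+1) q (x - k) (y - k)
      else if (j ≤ x ∧ x < y ∧ y ≤ j + (k + 1)) ∧ ¬(x = j ∧ y = j + (k + 1)) then
        r.lab (x - j + 1) (y - j + 1)
      else if x = j ∧ y = j + (k + 1) then compLab p (i+1) q j (j + 1) * r.lab 1 (k + 2)
      else 1 := by
  rw [compLab]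
  split_ifs
  · rw [lab_comp _ _ _ _ _ (by omega)]
  · rw [lab_comp _ _ _ _ _ (by omega)]; congr 1; omega
  · rw [lab_comp _ _ _ _ _ (by omega)]; congr 1 <;> omega
  · rfl
  · rw [lab_comp _ _ _ _ _ (by omega)]
  · rfl


theorem compLab_comp_right (i : ℕ) (j : Fin (m + 1)) (p : Clique M n) (q : Clique M m) (r : Clique M k)
    {x y : ℕ} (h2 : x < y) :
    compLab p i (comp j q r) x y = 
      if y ≤ i then p.lab x y
      else if (x ≤ i ∧ i + (m + k + 1) ≤ y) ∧ ¬(x = i ∧ y = i + (m + k + 1)) then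
        p.lab x (y - (m + k))
      else if i + (m + k + 1) ≤ x then p.lab (x - (m + k)) (y - (m + k))
      else if (i ≤ x ∧ x < y ∧ y ≤ i + (m + k + 1)) ∧ ¬(x = i ∧ y = i + (m + k + 1)) then
        compLab q (j + 1) r (x - i + 1) (y - i + 1)
      else if x = i ∧ y = i + (m + k + 1) then
        p.lab i (i + 1) * compLab q (j + 1) r 1 (m + k + 2)
      else 1 := by
  rw [compLab]
  split_ifs
  · rfl
  · congr 1; omega
  · congr 1 <;> omega
  · rw [lab_comp _ _ _ _ _ (by omega)]
  · rw [lab_comp _ _ _ _ _ (by omega)]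
  · rfl

set_option maxHeartbeats 4000000 in
theorem comp_assoc (p : Clique M n) (q : Clique M m) (r : Clique M k) (i : Fin (n + 1))
    (j : Fin (m + 1)) :
    arityCast (Nat.add_assoc n m k) (comp ⟨i + j, by omega⟩ (comp i p q) r) =
      comp i p (comp j q r) := by
  apply ext_lab
  intro x y h1 h2 h3
  rw [lab_arityCast, lab_comp _ _ _ _ _ (by omega), lab_comp _ _ _ _ _ (by omega),
    compLab_comp_left _ _ _ _ _ h1 h2 (by omega) (by simp) (by simp; omega), compLab_comp_right _ _ _ _ _ h2]
  obtain ⟨i, hi⟩ := i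
  obtain ⟨j, hj⟩ := j
  dsimp only
  rcases Nat.eq_zero_or_pos m with rfl | hm
  · obtain rfl : j = 0 := by omega
    simp only [compLab, lab_size_one q, mul_one, one_mul]
    grind (splits := 40)
  · unfold compLab
    grind (splits := 40)

set_option maxHeartbeats 4000000 in
theorem comp_comm (p : Clique M n) (q : Clique M m) (r : Clique M k) (i j : Fin (n + 1))
    (hij : i < j) :
    arityCast (Nat.add_right_comm n m k) (comp ⟨j + m, by omega⟩ (comp i p q) r) =
      comp ⟨i, by omega⟩ (comp j p r) q := by
  apply ext_lab
  intro x y h1 h2 h3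
  rw [lab_arityCast, lab_comp _ _ _ _ _ (by omega), lab_comp _ _ _ _ _ (by omega),
    compLab_comp_left _ _ _ _ _ h1 h2 (by omega) (by simp) (by simp; omega),
    compLab_comp_left _ _ _ _ _ h1 h2 (by omega) (by simp) (by simp; omega)]
  obtain ⟨i, hi⟩ := i
  obtain ⟨j, hj⟩ := j
  simp only [Fin.mk_lt_mk] at hij
  dsimp only
  unfold compLab
  grind (splits := 40)

theorem one_comp (p : Clique M n) : arityCast (Nat.zero_add n) (comp 0 one p) = p := by
  apply ext_lab
  intro x y h1 h2 h3
  rw [lab_arityCast, lab_comp _ _ _ _ _ (by omega)]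
  simp only [compLab, lab_size_one, one_mul, Fin.val_zero]
  grind

theorem comp_one (p : Clique M n) (i : Fin (n + 1)) : comp i p one = p := by
  apply ext_lab
  intro x y h1 h2 h3
  rw [lab_comp _ _ _ _ _ (by omega)]
  simp only [compLab, lab_size_one, mul_one]
  grind

/-- `(x, y)` is a diagonal of the clique of size `n + 1`: an arc which is neither an edge
`(x, x + 1)` nor the base `(1, n + 2)`. -/
def IsDiagonal (n x y : ℕ) : Prop :=
  1 ≤ x ∧ x < y ∧ y ≤ n + 2 ∧ y ≠ x + 1 ∧ ¬(x = 1 ∧ y = n + 2)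

def Crossing (x y x' y' : ℕ) : Prop :=
  (x < x' ∧ x' < y ∧ y < y') ∨ (x' < x ∧ x < y' ∧ y' < y)

/-- A clique is noncrossing if no two of its solid diagonals (those whose label is not the unit)
are crossing. -/
def Noncrossing (p : Clique M n) : Prop :=
  ∀ x y x' y', IsDiagonal n x y → IsDiagonal n x' y' → p.lab x y ≠ 1 → p.lab x' y' ≠ 1 →
    ¬ Crossing x y x' y'

theorem Noncrossing.wlog {p : Clique M n} (hp : ∀ x y x' y', x < x' → x' < y → y < y' → p.lab x y ≠ 1 → p.lab x' y' ≠ 1 → False) : p.Noncrossing := by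
  rintro x y x' y' - - h1 h2 (h | h)
  · exact hp x y x' y' h.1 h.2.1 h.2.2 h1 h2
  · exact hp x' y' x y h.1 h.2.1 h.2.2 h2 h1

theorem Noncrossing.elim {p : Clique M n} (hp : p.Noncrossing) {x y x' y' : ℕ} (h1 : x < x')
    (h2 : x' < y) (h3 : y < y') (h : p.lab x y ≠ 1) : p.lab x' y' = 1 := by
  by_contra h'
  have a : 1 ≤ x ∧ x < y ∧ y ≤ n + 2 := by by_contra hc; exact h (p.lab_outside hc)
  have b : 1 ≤ x' ∧ x' < y' ∧ y' ≤ n + 2 := by by_contra hc; exact h' (p.lab_outside hc)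
  refine hp x y x' y' ?_ ?_ h h' (Or.inl ⟨h1, h2, h3⟩) <;> unfold IsDiagonal <;> omega

set_option maxHeartbeats 4000000 in
theorem Noncrossing.comp {p : Clique M n} {q : Clique M m} (hp : p.Noncrossing)
    (hq : q.Noncrossing) (i : Fin (n + 1)) : (comp i p q).Noncrossing := by
  apply Noncrossing.wlog
  intro x y x' y' h1 h2 h3 h h'
  have a : 1 ≤ x ∧ x < y ∧ y ≤ n + m + 2 := by by_contra hc; exact h (lab_outside _ hc)
  have b : 1 ≤ x' ∧ x' < y' ∧ y' ≤ n + m + 2 := by by_contra hc; exact h' (lab_outside _ hc)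
  rw [lab_comp _ _ _ _ _ a, compLab] at h
  rw [lab_comp _ _ _ _ _ b, compLab] at h'
  have hp' := @Noncrossing.elim _ _ _ p hp
  have hq' := @Noncrossing.elim _ _ _ q hq
  split_ifs at h h' <;> first
    | omega
    | exact h rfl
    | exact h' rfl
    | exact h' (hp' (by omega) (by omega) (by omega) h)
    | exact h' (hq' (by omega) (by omega) (by omega) h)

theorem noncrossing_of_size_le_two (p : Clique M n) (hn : n ≤ 1) : p.Noncrossing := by
  intro x y x' y' h
  unfold IsDiagonal at h
  omega

/-- The set-operad of all `M`-cliques. -/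
def setOperad (M : Type v) [MulOneClass M] : SetOperad.{v} where
  obj n := Clique M n
  one := one
  comp i p q := comp i p q
  comp_assoc := comp_assoc
  comp_comm := comp_comm
  one_comp := one_comp
  comp_one := comp_one

end Clique

/-- The `M`-triangles, that is, the `M`-cliques of size `2`. -/
abbrev Triangle (M : Type v) [MulOneClass M] : Type v := Clique M 1

/-- The `M`-triangle with base `(1, 3)` labeled by `a`, first edge `(1, 2)` labeled by `b`, and
second edge `(2, 3)` labeled by `c`. -/
def Triangle.mk {M : Type v} [MulOneClass M] (a b c : M) : Triangle M where
  label e := if e.1 = (1, 3) then a else if e.1 = (1, 2) then b else c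
  label_of_size_one h := absurd h one_ne_zero

section CliqueOperads

variable (K : Type u) [Field K] (M : Type v) [MulOneClass M]

/-- The `M`-clique operad `C M`. -/
noncomputable def cliqueOperad : NSOperad.{u, max u v} K := (Clique.setOperad M).linear K

variable {M} in
/-- An `M`-clique as an element of the fundamental basis of `C M`. -/
noncomputable def cliqueBasis {n : ℕ} (p : Clique M n) : (cliqueOperad K M).obj n :=
  (Clique.setOperad M).basis K p

/-- The `M`-triangles, as a graded subset of `C M` (concentrated in arity `2`). -/
def triangleSet (n : ℕ) : Set ((cliqueOperad K M).obj n) :=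
  {x | n = 1 ∧ ∃ p : Clique M n, x = cliqueBasis K p}

/-- The suboperad `NC M` of `C M`: the linear span of all noncrossing `M`-cliques. -/
noncomputable def ncSuboperad : (cliqueOperad K M).Suboperad where
  carrier n := Submodule.span K {x | ∃ p : Clique M n, p.Noncrossing ∧ x = cliqueBasis K p}
  one_mem := Submodule.subset_span
    ⟨Clique.one, Clique.noncrossing_of_size_le_two _ (Nat.zero_le 1), rfl⟩
  comp_mem {n m} i x y hx hy := by
    have := Submodule.apply_mem_map₂ ((cliqueOperad K M).comp i) hx hy
    rw [Submodule.map₂_span_span] at this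
    refine Submodule.span_mono ?_ this
    rintro _ ⟨_, ⟨p, hp, rfl⟩, _, ⟨q, hq, rfl⟩, rfl⟩
    refine ⟨Clique.comp i p q, hp.comp hq i, ?_⟩
    exact ((Clique.setOperad M).linComp_single K i p q 1 1).trans (by rw [mul_one]; rfl)

/-- The noncrossing `M`-clique operad `NC M`. -/
noncomputable def ncOperad : NSOperad.{u, max u v} K := (ncSuboperad K M).toOperad

variable {M} in
/-- An `M`-triangle as an element of `NC M`. -/
noncomputable def ncTriangle (p : Triangle M) : (ncOperad K M).obj 1 :=
  (⟨cliqueBasis K p, Submodule.subset_span ⟨p, p.noncrossing_of_size_le_two le_rfl, rfl⟩⟩ :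
    (ncSuboperad K M).carrier 1)

end CliqueOperads

/-! ## Syntax trees on binary generators and free operads

A syntax tree on a set `G` of generators, all of arity `2`, is a binary tree whose internal nodes
are labeled by `G`, that is, an element of `BinaryTree G`. Its arity is its number of leaves and
its degree is its number of internal nodes. Leaves are numbered from `0` from left to right. -/

namespace SyntaxTree

variable {G : Type v}

/-- Grafting of the root of `s` on the leaf number `i` of a tree. -/
def graft : BinaryTree G → ℕ → BinaryTree G → BinaryTree G
  | .nil, _, s => s
  | .node g l r, i, s =>
    if i < l.numLeaves then .node g (graft l i s) r else .node g l (graft r (i - l.numLeaves) s)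

/-- Simultaneous grafting of `f j` on the leaf number `j`, for all leaves of a tree. -/
def graftAll : BinaryTree G → (ℕ → BinaryTree G) → BinaryTree G
  | .nil, f => f 0
  | .node g l r, f => .node g (graftAll l f) (graftAll r fun j => f (l.numLeaves + j))

/-- The tree with a single internal node, labeled by `g`. -/
def corolla (g : G) : BinaryTree G := .node g .nil .nil

theorem numLeaves_pos (t : BinaryTree G) : 0 < t.numLeaves := by
  rw [BinaryTree.numLeaves_eq_numNodes_succ]; omega

theorem numLeaves_graft (t s : BinaryTree G) (i : ℕ) (h : i < t.numLeaves) :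
    (graft t i s).numLeaves + 1 = t.numLeaves + s.numLeaves := by
  induction t generalizing i with
  | nil => simp [graft, add_comm]
  | node g l r hl hr =>
    simp only [BinaryTree.numLeaves] at h
    rw [graft]
    split_ifs with h'
    · have := hl i h'
      simp only [BinaryTree.numLeaves]; omega
    · have := hr (i - l.numLeaves) (by omega)
      simp only [BinaryTree.numLeaves]; omega

theorem graft_graft_assoc (t s r : BinaryTree G) (i j : ℕ) (hi : i < t.numLeaves)
    (hj : j < s.numLeaves) : graft (graft t i s) (i + j) r = graft t i (graft s j r) := by
  induction t generalizing i with
  | nil =>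
    obtain rfl : i = 0 := by simpa using hi
    simp [graft]
  | node g a b ha hb =>
    simp only [BinaryTree.numLeaves] at hi
    by_cases h : i < a.numLeaves
    · have h1 := numLeaves_graft a s i h
      simp only [graft, if_pos h]
      rw [if_pos (by omega), ha i h]
    · simp only [graft, if_neg h]
      rw [if_neg (by omega), show i + j - a.numLeaves = (i - a.numLeaves) + j by omega,
        hb (i - a.numLeaves) (by omega)]

theorem graft_graft_comm (t s r : BinaryTree G) (i j : ℕ) (hij : i < j) (hj : j < t.numLeaves) :
    graft (graft t i s) (j + s.numLeaves - 1) r = graft (graft t j r) i s := by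
  have hs := numLeaves_pos s
  induction t generalizing i j with
  | nil =>
    simp only [BinaryTree.numLeaves] at hj
    omega
  | node g a b ha hb =>
    simp only [BinaryTree.numLeaves] at hj
    by_cases h : j < a.numLeaves
    · have h1 := numLeaves_graft a s i (by omega)
      have h2 := numLeaves_graft a r j (by omega)
      have h3 := numLeaves_pos r
      simp only [graft, if_pos h, if_pos (hij.trans h)]
      rw [if_pos (by omega), if_pos (by omega), ha i j hij h]
    · by_cases h' : i < a.numLeaves
      · have h1 := numLeaves_graft a s i (by omega)
        simp only [graft, if_pos h', if_neg h]
        rw [if_neg (by omega)]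
        congr 2
        omega
      · simp only [graft, if_neg h', if_neg h]
        rw [if_neg (by omega), ← hb (i - a.numLeaves) (j - a.numLeaves) (by omega) (by omega)]
        congr 2
        omega

theorem graft_nil (t : BinaryTree G) (i : ℕ) : graft t i .nil = t := by
  induction t generalizing i with
  | nil => rfl
  | node g a b ha hb => rw [graft]; split_ifs <;> simp [ha, hb]

end SyntaxTree

/-- The syntax trees on `G` of arity `n + 1`. -/
def SynTree (G : Type v) (n : ℕ) : Type v := {t : BinaryTree G // t.numLeaves = n + 1}

/-- The set-operad of the syntax trees on `G`. -/
def SynTree.setOperad (G : Type v) : SetOperad.{v} where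
  obj n := SynTree G n
  one := ⟨.nil, rfl⟩
  comp {n m} i t s := ⟨SyntaxTree.graft t.1 i s.1, by
    have := SyntaxTree.numLeaves_graft t.1 s.1 i (by rw [t.2]; exact i.2)
    rw [t.2, s.2] at this
    omega⟩
  comp_assoc x y z i j := Subtype.ext <|
    (NSOperad.arityCast_subtype (fun n (t : BinaryTree G) => t.numLeaves = n + 1) _ _).trans <| by
      rw [NSOperad.arityCast_const]
      exact SyntaxTree.graft_graft_assoc _ _ _ _ _ (by rw [x.2]; exact i.2) (by rw [y.2]; exact j.2)
  comp_comm {n m k} x y z i j h := Subtype.ext <|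
    (NSOperad.arityCast_subtype (fun n (t : BinaryTree G) => t.numLeaves = n + 1) _ _).trans <| by
      rw [NSOperad.arityCast_const]
      have := SyntaxTree.graft_graft_comm x.1 y.1 z.1 i j h (by rw [x.2]; exact j.2)
      rw [y.2] at this
      exact this
  one_comp x := Subtype.ext <|
    (NSOperad.arityCast_subtype (fun n (t : BinaryTree G) => t.numLeaves = n + 1) _ _).trans <| by
      rw [NSOperad.arityCast_const]
      rfl
  comp_one x i := Subtype.ext (SyntaxTree.graft_nil _ _)

/-- The free operad `Free(Vect(G))` on a set `G` of generators of arity `2`: its component of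
arity `n + 1` has the syntax trees on `G` of arity `n + 1` as a basis. -/
noncomputable def freeOperad (K : Type u) [Field K] (G : Type v) : NSOperad.{u, max u v} K :=
  (SynTree.setOperad G).linear K

/-- A syntax tree as an element of the free operad. -/
noncomputable def treeBasis (K : Type u) [Field K] {G : Type v} {n : ℕ} (t : SynTree G n) :
    (freeOperad K G).obj n :=
  (SynTree.setOperad G).basis K t

/-- The corolla labeled by `g`, in the free operad. -/
noncomputable def freeCorolla (K : Type u) [Field K] {G : Type v} (g : G) :
    (freeOperad K G).obj 1 :=
  treeBasis K ⟨SyntaxTree.corolla g, rfl⟩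

/-- A graded subspace of the free operad is quadratic if it consists of linear combinations of
syntax trees of degree `2`. -/
def IsQuadratic {K : Type u} [Field K] {G : Type v}
    (R : ∀ n, Submodule K ((freeOperad K G).obj n)) : Prop :=
  ∀ n, R n ≤ Submodule.span K {x | ∃ t : SynTree G n, t.1.numNodes = 2 ∧ x = treeBasis K t}

/-! ## Rewrite rules on syntax trees -/

namespace RewriteRule

variable {G : Type v}

/-- `t` is rewritable in one step into `t'`: it is obtained by replacing in `t` an occurrence of a
pattern `s` by `s'`, where `s → s'`. Such an occurrence has a part `u` of `t` above it and the
trees `f 0, f 1, …` grafted on its leaves. -/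
def Step (rule : BinaryTree G → BinaryTree G → Prop) (t t' : BinaryTree G) : Prop :=
  ∃ (u : BinaryTree G) (i : ℕ) (s s' : BinaryTree G) (f : ℕ → BinaryTree G),
    i < u.numLeaves ∧ rule s s' ∧ t = SyntaxTree.graft u i (SyntaxTree.graftAll s f) ∧
      t' = SyntaxTree.graft u i (SyntaxTree.graftAll s' f)

def Terminating (rule : BinaryTree G → BinaryTree G → Prop) : Prop :=
  ¬ ∃ t : ℕ → BinaryTree G, ∀ j, Step rule (t j) (t (j + 1))

def Confluent (rule : BinaryTree G → BinaryTree G → Prop) : Prop :=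
  ∀ t r₁ r₂, Relation.ReflTransGen (Step rule) t r₁ → Relation.ReflTransGen (Step rule) t r₂ →
    ∃ t', Relation.ReflTransGen (Step rule) r₁ t' ∧ Relation.ReflTransGen (Step rule) r₂ t'

def Convergent (rule : BinaryTree G → BinaryTree G → Prop) : Prop :=
  Terminating rule ∧ Confluent rule

def IsNormalForm (rule : BinaryTree G → BinaryTree G → Prop) (t : BinaryTree G) : Prop :=
  ∀ t', ¬ Step rule t t'

/-- The generating series of the normal forms, enumerated by their arities. -/
noncomputable def normalFormSeries (rule : BinaryTree G → BinaryTree G → Prop) : PowerSeries ℕ :=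
  PowerSeries.mk fun n => Nat.card {t : BinaryTree G // t.numLeaves = n ∧ IsNormalForm rule t}

/-- The (graded) space induced by a rewrite rule: it is spanned by the differences of two trees
related by the reflexive, symmetric and transitive closure of the rule. -/
noncomputable def inducedSpace (K : Type u) [Field K] (rule : BinaryTree G → BinaryTree G → Prop) (n : ℕ) :
    Submodule K ((freeOperad K G).obj n) :=
  Submodule.span K {x | ∃ t t' : SynTree G n, Relation.EqvGen rule t.1 t'.1 ∧
    x = treeBasis K t - treeBasis K t'}

end RewriteRule

/-! ## The relations between triangles and their orientation -/

section NCPresentation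

variable (K : Type u) [Field K] (M : Type v) [MulOneClass M]

/-- The corolla `c(△)` labeled by the triangle with base `a` and edges `b`, `c`. -/
noncomputable abbrev triCorolla {M : Type v} [MulOneClass M] (a b c : M) :
    (freeOperad K (Triangle M)).obj 1 :=
  freeCorolla K (Triangle.mk a b c)

/-- The three families of relations, all in arity `3`. -/
inductive NCRelation : ∀ n, (freeOperad K (Triangle M)).obj n → Prop
  | rel1 (p₀ p₁ p₂ q₀ q₁ q₂ r₀ r₁ : M) (h : p₁ * q₀ = r₁ * r₀) (h' : r₁ * r₀ ≠ 1) :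
    NCRelation (1 + 1)
      ((freeOperad K (Triangle M)).comp 0 (triCorolla K p₀ p₁ p₂) (triCorolla K q₀ q₁ q₂) -
        (freeOperad K (Triangle M)).comp 0 (triCorolla K p₀ r₁ p₂) (triCorolla K r₀ q₁ q₂))
  | rel2 (p₀ p₁ p₂ q₀ q₁ q₂ r₀ r₂ : M) (h : p₁ * q₀ = 1) (h' : r₂ * r₀ = 1) :
    NCRelation (1 + 1)
      ((freeOperad K (Triangle M)).comp 0 (triCorolla K p₀ p₁ p₂) (triCorolla K q₀ q₁ q₂) -
        (freeOperad K (Triangle M)).comp 1 (triCorolla K p₀ q₁ r₂) (triCorolla K r₀ q₂ p₂))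
  | rel3 (p₀ p₁ p₂ q₀ q₁ q₂ r₀ r₂ : M) (h : p₂ * q₀ = r₂ * r₀) (h' : r₂ * r₀ ≠ 1) :
    NCRelation (1 + 1)
      ((freeOperad K (Triangle M)).comp 1 (triCorolla K p₀ p₁ p₂) (triCorolla K q₀ q₁ q₂) -
        (freeOperad K (Triangle M)).comp 1 (triCorolla K p₀ p₁ r₂) (triCorolla K r₀ q₁ q₂))

/-- The space of relations of `NC M`. -/
noncomputable def ncRelations (n : ℕ) : Submodule K ((freeOperad K (Triangle M)).obj n) :=
  Submodule.span K {x | NCRelation K M n x}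

/-- The quotient of the free operad on the `M`-triangles by the ideal generated by the
relations. -/
noncomputable def ncPresented : NSOperad.{u, max u v} K :=
  (NSOperad.OperadIdeal.generated (freeOperad K (Triangle M)) (ncRelations K M)).quotient

variable {M} in
/-- The class of the corolla labeled by the `M`-triangle `p`. -/
noncomputable def ncPresentedGenerator (p : Triangle M) : (ncPresented K M).obj 1 :=
  (NSOperad.OperadIdeal.generated (freeOperad K (Triangle M)) (ncRelations K M)).proj 1
    (freeCorolla K p)

open SyntaxTree in
/-- The rewrite rule orienting the relations. -/
inductive NCRule : BinaryTree (Triangle M) → BinaryTree (Triangle M) → Prop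
  | rule1 (p₀ p₁ p₂ q₀ q₁ q₂ : M) (h : q₀ ≠ 1) :
    NCRule (graft (corolla (Triangle.mk p₀ p₁ p₂)) 0 (corolla (Triangle.mk q₀ q₁ q₂)))
      (graft (corolla (Triangle.mk p₀ (p₁ * q₀) p₂)) 0 (corolla (Triangle.mk 1 q₁ q₂)))
  | rule2 (p₀ p₁ p₂ q₀ q₁ q₂ : M) (h : p₁ * q₀ = 1) :
    NCRule (graft (corolla (Triangle.mk p₀ p₁ p₂)) 0 (corolla (Triangle.mk q₀ q₁ q₂)))
      (graft (corolla (Triangle.mk p₀ q₁ 1)) 1 (corolla (Triangle.mk 1 q₂ p₂)))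
  | rule3 (p₀ p₁ p₂ q₀ q₁ q₂ : M) (h : q₀ ≠ 1) :
    NCRule (graft (corolla (Triangle.mk p₀ p₁ p₂)) 1 (corolla (Triangle.mk q₀ q₁ q₂)))
      (graft (corolla (Triangle.mk p₀ p₁ (p₂ * q₀))) 1 (corolla (Triangle.mk 1 q₁ q₂)))

end NCPresentation

/-! Evaluating syntax trees in the set-operad of `M`-cliques is a morphism of operads. A value is a
composition of triangles, hence noncrossing, and conversely a noncrossing clique of arity `n` at
least `2` is cut along the triangle on the vertices `1`, `z` and `n + 1`, where `(1, z)` is its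
longest solid arc other than the base, or its first edge if there is none: no solid arc crosses the
sides of this triangle. So `NC M` is the image of the free operad, and is generated by the
triangles.

The rewrite rule preserves the values, so it remains to see that it terminates and that distinct
normal forms have distinct values. In a normal form, every node other than the root has a trivial
base, and the first edge of a node with a nontrivial left subtree is solid. Hence the triangle at
the root is the one along which the value is cut, and the tree is recovered inductively. It follows
that two trees with the same value have a common normal form: the rule is confluent, its normal
forms are in bijection with the noncrossing cliques, and the kernel of the evaluation is the ideal
generated by the differences of the two members of the rules. -/

theorem ker_lmapDomain (R : Type*) [Ring R] {α β : Type*} (F : α → β) :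
    LinearMap.ker (Finsupp.lmapDomain R R F) =
      Submodule.span R {x | ∃ a b, F a = F b ∧ x = Finsupp.single a 1 - Finsupp.single b 1} := by
  set N := Submodule.span R {x : α →₀ R | ∃ a b, F a = F b ∧
    x = Finsupp.single a 1 - Finsupp.single b 1}
  refine le_antisymm (fun x hx => ?_) (Submodule.span_le.2 ?_)
  · cases isEmpty_or_nonempty α with
    | inl _ => simp only [Subsingleton.elim x 0, zero_mem]
    | inr _ =>
      let σ : α → α := Function.invFun F ∘ F
      have single_sub_single_mem (a : α) : Finsupp.single a 1 - Finsupp.single (σ a) 1 ∈ N :=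
        Submodule.subset_span ⟨a, σ a, (Function.invFun_eq ⟨a, rfl⟩).symm, rfl⟩
      have sub_mapDomain_mem (y : α →₀ R) : y - y.mapDomain σ ∈ N := by
        induction y using Finsupp.induction_linear with
        | zero => simp only [Finsupp.mapDomain_zero, sub_zero, zero_mem]
        | add y z hy hz => simpa only [Finsupp.mapDomain_add, add_sub_add_comm] using add_mem hy hz
        | single a c =>
          simpa only [Finsupp.mapDomain_single, smul_sub, Finsupp.smul_single, smul_eq_mul,
            mul_one] using N.smul_mem c (single_sub_single_mem a)
      have mapDomain_eq_zero : x.mapDomain σ = 0 := by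
        rw [Finsupp.mapDomain_comp, show x.mapDomain F = 0 from hx, Finsupp.mapDomain_zero]
      simpa only [mapDomain_eq_zero, sub_zero] using sub_mapDomain_mem x
  · rintro _ ⟨a, b, h, rfl⟩
    simp only [SetLike.mem_coe, LinearMap.mem_ker, map_sub, Finsupp.lmapDomain_apply,
      Finsupp.mapDomain_single, h, sub_self]

section AbstractRewriting

open Relation

variable {α β : Type*} {r : α → α → Prop}

theorem exists_reflTransGen_irreducible (hr : WellFounded (flip r)) (a : α) :
    ∃ b, ReflTransGen r a b ∧ ∀ c, ¬ r b c := by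
  obtain ⟨b, hab, hb⟩ := hr.has_min {b | ReflTransGen r a b} ⟨a, .refl⟩
  exact ⟨b, hab, fun c hbc => hb c (hab.tail hbc) hbc⟩

theorem reflTransGen_map_eq {F : α → β} (hF : ∀ a b, r a b → F a = F b) {a b : α}
    (h : ReflTransGen r a b) : F a = F b := by
  induction h with
  | refl => rfl
  | tail _ hbc ih => exact ih.trans (hF _ _ hbc)

theorem join_of_injOn_irreducible (hr : WellFounded (flip r)) {F : α → β}
    (hF : ∀ a b, r a b → F a = F b) (hinj : Set.InjOn F {a | ∀ c, ¬ r a c})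
    {a b : α} (h : F a = F b) : Join (ReflTransGen r) a b := by
  obtain ⟨a', haa', ha'⟩ := exists_reflTransGen_irreducible hr a
  obtain ⟨b', hbb', hb'⟩ := exists_reflTransGen_irreducible hr b
  have hab' : F a' = F b' :=
    (reflTransGen_map_eq hF haa').symm.trans (h.trans (reflTransGen_map_eq hF hbb'))
  exact ⟨a', haa', hinj ha' hb' hab' ▸ hbb'⟩

end AbstractRewriting

theorem sigma_mk_arityCast {O : ℕ → Type u} {a b : ℕ} (h : a = b) (x : O a) :
    (⟨b, arityCast h x⟩ : Σ n, O n) = ⟨a, x⟩ := by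
  subst h; rfl

namespace NSOperad

variable {K : Type u} [Field K] {O : NSOperad.{u, v} K} {P : NSOperad.{u, w} K}

/-- Operad morphisms. -/
structure Hom (O : NSOperad.{u, v} K) (P : NSOperad.{u, w} K) where
  toLinearMap : ∀ n, O.obj n →ₗ[K] P.obj n
  map_one : toLinearMap 0 O.one = P.one
  map_comp : ∀ {n m : ℕ} (i : Fin (n + 1)) (x : O.obj n) (y : O.obj m),
    toLinearMap (n + m) (O.comp i x y) = P.comp i (toLinearMap n x) (toLinearMap m y)

namespace Hom

/-- The kernel of an operad morphism. -/
def ker (φ : Hom O P) : O.OperadIdeal where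
  carrier n := LinearMap.ker (φ.toLinearMap n)
  comp_mem_left i x y hy := by
    rw [LinearMap.mem_ker, φ.map_comp, LinearMap.mem_ker.1 hy, _root_.map_zero]
  comp_mem_right i x y hx := by
    rw [LinearMap.mem_ker, φ.map_comp, LinearMap.mem_ker.1 hx, _root_.map_zero,
      LinearMap.zero_apply]

/-- The image of an operad morphism. -/
def range (φ : Hom O P) : P.Suboperad where
  carrier n := LinearMap.range (φ.toLinearMap n)
  one_mem := ⟨O.one, φ.map_one⟩
  comp_mem := by
    rintro n m i _ _ ⟨x, rfl⟩ ⟨y, rfl⟩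
    exact ⟨O.comp i x y, φ.map_comp i x y⟩

/-- The first isomorphism theorem for operads. -/
noncomputable def quotientKerIsoRange (φ : Hom O P) : Iso φ.ker.quotient φ.range.toOperad where
  toEquiv n := (φ.toLinearMap n).quotKerEquivRange
  map_one := Subtype.ext φ.map_one
  map_comp i x y := by
    induction x using Submodule.Quotient.induction_on with | _ x
    induction y using Submodule.Quotient.induction_on with | _ y
    exact Subtype.ext (φ.map_comp i x y)

theorem exists_iso_of_ker_of_range {φ : Hom O P} {I : O.OperadIdeal} {Q : P.Suboperad}
    (hI : I = φ.ker) (hQ : Q = φ.range) :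
    ∃ ψ : Iso I.quotient Q.toOperad,
      ∀ n x, (show Q.carrier n from ψ.toEquiv n (I.proj n x)).1 = φ.toLinearMap n x := by
  subst hI hQ
  exact ⟨φ.quotientKerIsoRange, fun _ _ => rfl⟩

end Hom

/-- The inverse image of a suboperad under an operad morphism. -/
def Suboperad.comap (φ : Hom O P) (Q : P.Suboperad) : O.Suboperad where
  carrier n := (Q.carrier n).comap (φ.toLinearMap n)
  one_mem := by rw [Submodule.mem_comap, φ.map_one]; exact Q.one_mem
  comp_mem i x y hx hy := by
    rw [Submodule.mem_comap, φ.map_comp]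
    exact Q.comp_mem i hx hy

theorem Suboperad.generated_le {G : ∀ n, Set (O.obj n)} {Q : O.Suboperad}
    (h : ∀ n, G n ⊆ Q.carrier n) (n : ℕ) :
    (Suboperad.generated O G).carrier n ≤ Q.carrier n :=
  iInf_le (fun Q : {Q : O.Suboperad // ∀ n, G n ⊆ Q.carrier n} => Q.1.carrier n) ⟨Q, h⟩

theorem Suboperad.subset_generated (G : ∀ n, Set (O.obj n)) (n : ℕ) :
    G n ⊆ (Suboperad.generated O G).carrier n :=
  fun _ hx => (Submodule.mem_iInf _).2 fun Q => Q.2 n hx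

theorem OperadIdeal.generated_le {R : ∀ n, Submodule K (O.obj n)} {I : O.OperadIdeal}
    (h : ∀ n, R n ≤ I.carrier n) (n : ℕ) :
    (OperadIdeal.generated O R).carrier n ≤ I.carrier n :=
  iInf_le (fun I : {I : O.OperadIdeal // ∀ n, R n ≤ I.carrier n} => I.1.carrier n) ⟨I, h⟩

theorem OperadIdeal.le_generated (R : ∀ n, Submodule K (O.obj n)) (n : ℕ) :
    R n ≤ (OperadIdeal.generated O R).carrier n :=
  le_iInf fun I => I.2 n

end NSOperad

namespace SetOperad

variable {S : SetOperad.{v}} {T : SetOperad.{w}}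

/-- Morphisms of set-operads. -/
structure Hom (S : SetOperad.{v}) (T : SetOperad.{w}) where
  toFun : ∀ n, S.obj n → T.obj n
  map_one : toFun 0 S.one = T.one
  map_comp : ∀ {n m : ℕ} (i : Fin (n + 1)) (x : S.obj n) (y : S.obj m),
    toFun (n + m) (S.comp i x y) = T.comp i (toFun n x) (toFun m y)

theorem linear_comp_basis (K : Type u) [Field K] {n m : ℕ} (i : Fin (n + 1)) (x : S.obj n)
    (y : S.obj m) :
    (S.linear K).comp i (S.basis K x) (S.basis K y) = S.basis K (S.comp i x y) :=
  (S.linComp_single K i x y 1 1).trans (by rw [mul_one, basis])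

theorem Hom.mapDomain_linComp (K : Type u) [Field K] (φ : Hom S T) {n m : ℕ} (i : Fin (n + 1))
    (x : S.obj n →₀ K) (y : S.obj m →₀ K) :
    (S.linComp K i x y).mapDomain (φ.toFun (n + m)) =
      T.linComp K i (x.mapDomain (φ.toFun n)) (y.mapDomain (φ.toFun m)) := by
  induction x using Finsupp.induction_linear with
  | zero => simp only [map_zero, LinearMap.zero_apply, Finsupp.mapDomain_zero]
  | add x x' hx hx' => simp only [map_add, LinearMap.add_apply, Finsupp.mapDomain_add, hx, hx']
  | single x a =>
  induction y using Finsupp.induction_linear with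
  | zero => simp only [map_zero, Finsupp.mapDomain_zero]
  | add y y' hy hy' => simp only [map_add, Finsupp.mapDomain_add, hy, hy']
  | single y b => simp only [linComp_single, Finsupp.mapDomain_single, φ.map_comp]

/-- The linear extension of a morphism of set-operads. -/
noncomputable def Hom.linearize (K : Type u) [Field K] (φ : Hom S T) :
    NSOperad.Hom (S.linear K) (T.linear K) where
  toLinearMap n := Finsupp.lmapDomain K K (φ.toFun n)
  map_one := Finsupp.mapDomain_single.trans (congrArg (Finsupp.single · 1) φ.map_one)
  map_comp i x y := φ.mapDomain_linComp K i x y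

theorem Hom.linearize_basis (K : Type u) [Field K] (φ : Hom S T) {n : ℕ} (x : S.obj n) :
    (φ.linearize K).toLinearMap n (S.basis K x) = T.basis K (φ.toFun n x) :=
  Finsupp.mapDomain_single

/-- The elements of a set-operad, of all arities. -/
abbrev Total (S : SetOperad.{v}) : Type v := Σ n, S.obj n

namespace Total

/-- Partial composition on elements of all arities, which spares the transports along equalities
of arities. The inputs are numbered from `0`, and the junk value `x` is returned if `x` has no
input number `i`. -/
def comp (i : ℕ) (x y : S.Total) : S.Total :=
  if h : i < x.1 + 1 then ⟨x.1 + y.1, S.comp ⟨i, h⟩ x.2 y.2⟩ else x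

theorem comp_of_lt {i : ℕ} {x y : S.Total} (h : i < x.1 + 1) :
    comp i x y = ⟨x.1 + y.1, S.comp ⟨i, h⟩ x.2 y.2⟩ :=
  dif_pos h

theorem comp_fst {i : ℕ} {x y : S.Total} (h : i < x.1 + 1) : (comp i x y).1 = x.1 + y.1 := by
  rw [comp_of_lt h]

theorem comp_assoc {i j : ℕ} {x y z : S.Total} (hi : i < x.1 + 1) (hj : j < y.1 + 1) :
    comp (i + j) (comp i x y) z = comp i x (comp j y z) := by
  rw [comp_of_lt hi, comp_of_lt hj, comp_of_lt hi, comp_of_lt (by dsimp only; omega),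
    ← S.comp_assoc x.2 y.2 z.2 ⟨i, hi⟩ ⟨j, hj⟩]
  exact (sigma_mk_arityCast _ _).symm

theorem comp_comm {i j : ℕ} {x y z : S.Total} (hij : i < j) (hj : j < x.1 + 1) :
    comp (j + y.1) (comp i x y) z = comp i (comp j x z) y := by
  have hi := hij.trans hj
  rw [comp_of_lt hi, comp_of_lt hj, comp_of_lt (by dsimp only; omega),
    comp_of_lt (by dsimp only; omega),
    ← S.comp_comm x.2 y.2 z.2 ⟨i, hi⟩ ⟨j, hj⟩ hij]
  exact (sigma_mk_arityCast _ _).symm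

theorem one_comp (x : S.Total) : comp 0 ⟨0, S.one⟩ x = x := by
  rw [comp_of_lt (Nat.succ_pos _), ← sigma_mk_arityCast (Nat.zero_add x.1)]
  exact Sigma.ext rfl (heq_of_eq (S.one_comp x.2))

theorem comp_one {i : ℕ} {x : S.Total} : comp i x ⟨0, S.one⟩ = x := by
  unfold comp
  split_ifs with h
  · exact Sigma.ext rfl (heq_of_eq (S.comp_one x.2 ⟨i, h⟩))
  · rfl

end Total

end SetOperad

/-! ## Evaluation of syntax trees -/

namespace SyntaxTree

open SetOperad (Total)

variable {G : Type v}

section Lift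

variable {S : SetOperad.{w}} (γ : G → S.obj 1)

/-- The value of a syntax tree whose generators are interpreted in a set-operad by `γ`. -/
def lift : BinaryTree G → S.Total
  | .nil => ⟨0, S.one⟩
  | .node g a b => Total.comp 0 (Total.comp 1 ⟨1, γ g⟩ (lift b)) (lift a)

theorem lift_fst_add_one (t : BinaryTree G) : (lift γ t).1 + 1 = t.numLeaves := by
  induction t with
  | nil => rfl
  | node g a b ha hb =>
    rw [lift, Total.comp_fst (Nat.succ_pos _), Total.comp_fst (by dsimp only; omega),
      BinaryTree.numLeaves]
    dsimp only
    omega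

theorem lift_node_ne_lift_nil (g : G) (a b : BinaryTree G) :
    lift γ (.node g a b) ≠ lift γ .nil := by
  intro h
  have hleaves := lift_fst_add_one γ (.node g a b)
  rw [h, lift_fst_add_one, BinaryTree.numLeaves, BinaryTree.numLeaves] at hleaves
  have ha := numLeaves_pos a
  have hb := numLeaves_pos b
  omega

theorem lift_corolla (g : G) : lift γ (corolla g) = ⟨1, γ g⟩ := by
  simp only [corolla, lift, Total.comp_one]

theorem lift_graft (t s : BinaryTree G) {i : ℕ} (h : i < t.numLeaves) :
    lift γ (graft t i s) = Total.comp i (lift γ t) (lift γ s) := by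
  induction t generalizing i with
  | nil =>
    obtain rfl : i = 0 := by simpa using h
    exact (Total.one_comp _).symm
  | node g a b ha hb =>
    have ha' := lift_fst_add_one γ a
    have hb' := lift_fst_add_one γ b
    rw [BinaryTree.numLeaves] at h
    rw [graft]
    split_ifs with hi
    · rw [lift, lift, ha hi, ← Total.comp_assoc (Nat.succ_pos _) (by omega), zero_add]
    · rw [lift, lift, hb (by omega), ← Total.comp_assoc (by dsimp only; omega) (by omega),
        ← Total.comp_comm (by omega) (by rw [Total.comp_fst] <;> dsimp only <;> omega),
        show 1 + (i - a.numLeaves) + (lift γ a).1 = i by omega]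

theorem lift_fst_eq {n : ℕ} (t : SynTree G n) : (lift γ t.1).1 = n :=
  Nat.succ_injective ((lift_fst_add_one γ t.1).trans t.2)

/-- The value in `S.obj n` of a syntax tree of arity `n + 1`. -/
def liftAt {n : ℕ} (t : SynTree G n) : S.obj n :=
  arityCast (lift_fst_eq γ t) (lift γ t.1).2

theorem sigma_mk_liftAt {n : ℕ} (t : SynTree G n) : (⟨n, liftAt γ t⟩ : S.Total) = lift γ t.1 :=
  sigma_mk_arityCast _ _

theorem liftAt_eq_iff {n : ℕ} (t : SynTree G n) (x : S.obj n) :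
    liftAt γ t = x ↔ lift γ t.1 = ⟨n, x⟩ := by
  rw [← sigma_mk_liftAt, sigma_mk_injective.eq_iff]

/-- The unique extension of `γ` to a morphism of set-operads. -/
def liftHom : SetOperad.Hom (SynTree.setOperad G) S where
  toFun _ t := liftAt γ t
  map_one := rfl
  map_comp {n m} i t s := by
    refine (liftAt_eq_iff γ _ _).2 ((lift_graft γ t.1 s.1 (i.2.trans_eq t.2.symm)).trans ?_)
    rw [← sigma_mk_liftAt γ t, ← sigma_mk_liftAt γ s, Total.comp_of_lt i.2]

theorem liftAt_eq_liftAt_iff {n : ℕ} {t s : SynTree G n} :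
    liftAt γ t = liftAt γ s ↔ lift γ t.1 = lift γ s.1 := by
  rw [liftAt_eq_iff, sigma_mk_liftAt]

end Lift

end SyntaxTree

section FreeOperad

open SyntaxTree

variable {K : Type u} [Field K] {G : Type v}

theorem freeOperad_comp_treeBasis {n m : ℕ} (i : Fin (n + 1)) (t : SynTree G n)
    (s : SynTree G m) :
    (freeOperad K G).comp i (treeBasis K t) (treeBasis K s) =
      treeBasis K ((SynTree.setOperad G).comp i t s) :=
  SetOperad.linear_comp_basis (S := SynTree.setOperad G) K i t s

theorem freeOperad_comp_comp_freeCorolla {k m : ℕ} (g : G) {a b : BinaryTree G}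
    (ha : a.numLeaves = k + 1) (hb : b.numLeaves = m + 1)
    (h : (BinaryTree.node g a b).numLeaves = 1 + m + k + 1) :
    (freeOperad K G).comp 0 ((freeOperad K G).comp 1 (freeCorolla K g) (treeBasis K ⟨b, hb⟩))
      (treeBasis K ⟨a, ha⟩) = treeBasis K ⟨.node g a b, h⟩ :=
  (congrArg (fun x => (freeOperad K G).comp 0 x (treeBasis K ⟨a, ha⟩))
    (freeOperad_comp_treeBasis 1 _ _)).trans (freeOperad_comp_treeBasis 0 _ _)

theorem treeBasis_mem_of_freeCorolla_mem {Q : (freeOperad K G).Suboperad}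
    (hQ : ∀ g, freeCorolla K g ∈ Q.carrier 1) {n : ℕ} (t : SynTree G n) :
    treeBasis K t ∈ Q.carrier n := by
  obtain ⟨t, ht⟩ := t
  induction t generalizing n with
  | nil =>
    obtain rfl : n = 0 := Nat.succ_injective ht.symm
    exact Q.one_mem
  | node g a b ha hb =>
    obtain ⟨k, hk⟩ := Nat.exists_eq_add_one.2 (numLeaves_pos a)
    obtain ⟨m, hm⟩ := Nat.exists_eq_add_one.2 (numLeaves_pos b)
    obtain rfl : n = 1 + m + k := by
      rw [BinaryTree.numLeaves] at ht
      omega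
    rw [← freeOperad_comp_comp_freeCorolla g hk hm ht]
    exact Q.comp_mem 0 (Q.comp_mem 1 (hQ g) (hb hm)) (ha hk)

theorem NSOperad.Hom.range_le_of_freeCorolla_mem {O : NSOperad.{u, w} K}
    (φ : NSOperad.Hom (freeOperad K G) O) {Q : O.Suboperad}
    (hQ : ∀ g, φ.toLinearMap 1 (freeCorolla K g) ∈ Q.carrier 1) (n : ℕ) :
    φ.range.carrier n ≤ Q.carrier n := by
  rintro _ ⟨x, rfl⟩
  induction x using Finsupp.induction_linear with
  | zero => exact (map_zero (φ.toLinearMap n)).symm ▸ zero_mem _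
  | add x y hx hy => exact (map_add (φ.toLinearMap n) x y).symm ▸ add_mem hx hy
  | single t c =>
    have single_eq : Finsupp.single t c = c • treeBasis K t :=
      ((Finsupp.smul_single c t 1).trans (by rw [smul_eq_mul, mul_one])).symm
    rw [single_eq]
    exact ((Q.comap φ).carrier n).smul_mem c
      (treeBasis_mem_of_freeCorolla_mem (Q := Q.comap φ) hQ t)

section FreeOperadHom

variable (K) {S : SetOperad.{w}} (γ : G → S.obj 1)

/-- The unique operad morphism sending the corolla labeled by `g` to the basis element `γ g`. -/
noncomputable def freeOperadHom : NSOperad.Hom (freeOperad K G) (S.linear K) :=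
  (liftHom γ).linearize K

theorem freeOperadHom_treeBasis {n : ℕ} (t : SynTree G n) :
    (freeOperadHom K γ).toLinearMap n (treeBasis K t) = S.basis K (liftAt γ t) :=
  (liftHom γ).linearize_basis K t

theorem freeOperadHom_freeCorolla (g : G) :
    (freeOperadHom K γ).toLinearMap 1 (freeCorolla K g) = S.basis K (γ g) :=
  (freeOperadHom_treeBasis K γ _).trans
    (congrArg (S.basis K) ((liftAt_eq_iff γ _ _).2 (lift_corolla γ g)))

theorem freeOperadHom_ker_carrier (n : ℕ) :
    (freeOperadHom K γ).ker.carrier n = Submodule.span K {x | ∃ t s : SynTree G n,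
      lift γ t.1 = lift γ s.1 ∧ x = treeBasis K t - treeBasis K s} := by
  simp only [← liftAt_eq_liftAt_iff]
  exact ker_lmapDomain K fun t : SynTree G n => liftAt γ t

theorem freeOperadHom_range_carrier (n : ℕ) :
    (freeOperadHom K γ).range.carrier n =
      Submodule.span K (Set.range fun t : SynTree G n => S.basis K (liftAt γ t)) :=
  Finsupp.range_lmapDomain fun t : SynTree G n => liftAt γ t

end FreeOperadHom

end FreeOperad

/-! ## Congruences on syntax trees -/

namespace SyntaxTree

variable {G : Type v}

theorem graftAll_eq_self {t : BinaryTree G} {f : ℕ → BinaryTree G}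
    (hf : ∀ j < t.numLeaves, f j = .nil) : graftAll t f = t := by
  induction t generalizing f with
  | nil => exact hf 0 Nat.one_pos
  | node g a b ha hb =>
    rw [graftAll, ha fun j hj => hf j (by rw [BinaryTree.numLeaves]; omega),
      hb fun j hj => hf _ (by rw [BinaryTree.numLeaves]; omega)]

theorem numLeaves_le_numLeaves_graftAll (t : BinaryTree G) (f : ℕ → BinaryTree G) :
    t.numLeaves ≤ (graftAll t f).numLeaves := by
  induction t generalizing f with
  | nil => exact numLeaves_pos _
  | node _ a b ha hb => exact Nat.add_le_add (ha f) (hb _)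

theorem graftAll_eq_graft {t : BinaryTree G} {f : ℕ → BinaryTree G} {k : ℕ}
    (hk : k < t.numLeaves) (hf : ∀ j < k, f j = .nil) :
    graftAll t f = graft (graftAll t (Function.update f k .nil)) k (f k) := by
  induction t generalizing f k with
  | nil =>
    obtain rfl : k = 0 := by simpa using hk
    simp only [graftAll, Function.update_self, graft]
  | node g a b ha hb =>
    rw [BinaryTree.numLeaves] at hk
    by_cases hka : k < a.numLeaves
    · have hupdate (j : ℕ) : Function.update f k .nil (a.numLeaves + j) = f (a.numLeaves + j) :=
        Function.update_of_ne (by omega) _ _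
      simp only [graftAll, graft, hupdate]
      rw [if_pos (hka.trans_le (numLeaves_le_numLeaves_graftAll _ _)), ← ha hka hf]
    · have hupdate : (fun j => Function.update f k .nil (a.numLeaves + j)) =
          Function.update (fun j => f (a.numLeaves + j)) (k - a.numLeaves) .nil := by
        funext j
        simp only [Function.update_apply, show a.numLeaves + j = k ↔ j = k - a.numLeaves by omega]
      have graftAll_left {f' : ℕ → BinaryTree G} (hf' : ∀ j < k, f' j = .nil) :
          graftAll a f' = a :=
        graftAll_eq_self fun j hj => hf' j (by omega)
      rw [graftAll, graftAll, graftAll_left hf,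
        graftAll_left fun j hj => (Function.update_of_ne hj.ne _ _).trans (hf j hj), graft,
        if_neg hka, hupdate,
        hb (f := fun j => f (a.numLeaves + j)) (k := k - a.numLeaves) (by omega)
          (fun j hj => hf _ (by omega)),
        show a.numLeaves + (k - a.numLeaves) = k by omega]

theorem graftAll_left_comb (p q : G) (f : ℕ → BinaryTree G) :
    graftAll (graft (corolla p) 0 (corolla q)) f = .node p (.node q (f 0) (f 1)) (f 2) := rfl

theorem graftAll_right_comb (p q : G) (f : ℕ → BinaryTree G) :
    graftAll (graft (corolla p) 1 (corolla q)) f = .node p (f 0) (.node q (f 1) (f 2)) := rfl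

/-- Congruences on syntax trees: the equivalence relations which preserve the arity and are
compatible with grafting. -/
structure IsCongruence (r : BinaryTree G → BinaryTree G → Prop) : Prop where
  equivalence : Equivalence r
  numLeaves_eq : ∀ {t s}, r t s → t.numLeaves = s.numLeaves
  graft_left : ∀ (t) {s s'} (i), i < t.numLeaves → r s s' → r (graft t i s) (graft t i s')
  graft_right : ∀ {t t'} (s) (i), i < t.numLeaves → r t t' → r (graft t i s) (graft t' i s)

namespace IsCongruence

variable {r : BinaryTree G → BinaryTree G → Prop}

-- The trees are grafted from the last leaf to the first, which keeps the numbers of the other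
-- leaves unchanged.
theorem graftAll (hr : IsCongruence r) {s s' : BinaryTree G} (h : r s s')
    (f : ℕ → BinaryTree G) : r (graftAll s f) (graftAll s' f) := by
  have hleaves := hr.numLeaves_eq h
  suffices ∀ d f, (∀ j, j + d < s.numLeaves → f j = .nil) →
      r (SyntaxTree.graftAll s f) (SyntaxTree.graftAll s' f) from
    this s.numLeaves f fun j hj => absurd hj (by omega)
  intro d
  induction d with
  | zero =>
    intro f hf
    rwa [graftAll_eq_self hf, graftAll_eq_self fun j hj => hf j (hleaves ▸ hj)]
  | succ d ih =>
    intro f hf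
    by_cases hd : d < s.numLeaves
    · set k := s.numLeaves - (d + 1)
      have hk : k < s.numLeaves := by omega
      have hfk : ∀ j < k, f j = .nil := fun j hj => hf j (by omega)
      rw [graftAll_eq_graft hk hfk, graftAll_eq_graft (hleaves ▸ hk) hfk]
      refine hr.graft_right _ _ (hk.trans_le (numLeaves_le_numLeaves_graftAll _ _)) (ih _ ?_)
      intro j hj
      rcases eq_or_ne j k with rfl | hjk
      · exact Function.update_self _ _ _
      · exact (Function.update_of_ne hjk _ _).trans (hf j (by omega))
    · exact ih f fun j hj => hf j (by omega)

theorem of_step (hr : IsCongruence r) {rule : BinaryTree G → BinaryTree G → Prop}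
    (hrule : ∀ s s', rule s s' → r s s') {t t' : BinaryTree G}
    (h : RewriteRule.Step rule t t') : r t t' := by
  obtain ⟨u, i, s, s', f, hi, hss', rfl, rfl⟩ := h
  exact hr.graft_left u i hi (hr.graftAll (hrule s s' hss') f)

end IsCongruence

theorem isCongruence_lift {S : SetOperad.{w}} (γ : G → S.obj 1) :
    IsCongruence fun t s => lift γ t = lift γ s where
  equivalence := ⟨fun _ => rfl, Eq.symm, Eq.trans⟩
  numLeaves_eq h := by rw [← lift_fst_add_one γ, h, lift_fst_add_one]
  graft_left t s s' i hi h := by rw [lift_graft γ t s hi, lift_graft γ t s' hi, h]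
  graft_right {t t'} s i hi h := by
    have hi' : i < t'.numLeaves := by rwa [← lift_fst_add_one γ, ← h, lift_fst_add_one]
    rw [lift_graft γ t s hi, lift_graft γ t' s hi', h]

section TreeCongr

variable {K : Type u} [Field K]

/-- Two syntax trees are congruent modulo a graded subspace of the free operad if they have the
same arity and their difference lies in this subspace. -/
def TreeCongr (R : ∀ n, Submodule K ((freeOperad K G).obj n)) (t s : BinaryTree G) : Prop :=
  ∃ (n : ℕ) (x y : SynTree G n), x.1 = t ∧ y.1 = s ∧ treeBasis K x - treeBasis K y ∈ R n

theorem treeCongr_iff {R : ∀ n, Submodule K ((freeOperad K G).obj n)} {n : ℕ}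
    {t s : SynTree G n} : TreeCongr R t.1 s.1 ↔ treeBasis K t - treeBasis K s ∈ R n := by
  refine ⟨?_, fun h => ⟨n, t, s, rfl, rfl, h⟩⟩
  rintro ⟨m, x, y, hx, hy, h⟩
  obtain rfl : n = m := Nat.succ_injective (t.2.symm.trans (hx ▸ x.2))
  rwa [Subtype.ext hx, Subtype.ext hy] at h

theorem exists_synTree (t : BinaryTree G) : ∃ (n : ℕ) (x : SynTree G n), x.1 = t := by
  obtain ⟨n, hn⟩ := Nat.exists_eq_add_one.2 (numLeaves_pos t)
  exact ⟨n, ⟨t, hn⟩, rfl⟩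

theorem treeCongr_equivalence (R : ∀ n, Submodule K ((freeOperad K G).obj n)) :
    Equivalence (TreeCongr R) where
  refl t := by
    obtain ⟨n, x, rfl⟩ := exists_synTree t
    exact treeCongr_iff.2 (by rw [sub_self]; exact zero_mem _)
  symm := by
    rintro _ _ ⟨n, x, y, rfl, rfl, h⟩
    exact treeCongr_iff.2 (by rw [← neg_sub]; exact neg_mem h)
  trans := by
    rintro _ _ _ ⟨n, x, y, rfl, rfl, h⟩ ⟨m, y', z, hy', rfl, h'⟩
    obtain rfl : n = m := Nat.succ_injective (y.2.symm.trans (hy' ▸ y'.2))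
    obtain rfl : y' = y := Subtype.ext hy'
    exact treeCongr_iff.2 (by rw [← sub_add_sub_cancel]; exact add_mem h h')

theorem isCongruence_treeCongr (I : (freeOperad K G).OperadIdeal) :
    IsCongruence (TreeCongr I.carrier) where
  equivalence := treeCongr_equivalence _
  numLeaves_eq := by
    rintro _ _ ⟨n, x, y, rfl, rfl, -⟩
    exact x.2.trans y.2.symm
  graft_left := by
    rintro t _ _ i hi ⟨m, x, y, rfl, rfl, h⟩
    obtain ⟨n, u, rfl⟩ := exists_synTree t
    have hcomp := I.comp_mem_left ⟨i, u.2 ▸ hi⟩ (treeBasis K u) h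
    rw [map_sub, freeOperad_comp_treeBasis, freeOperad_comp_treeBasis] at hcomp
    exact treeCongr_iff.2 hcomp
  graft_right := by
    rintro _ _ s i hi ⟨n, x, y, rfl, rfl, h⟩
    obtain ⟨m, z, rfl⟩ := exists_synTree s
    have hcomp := I.comp_mem_right ⟨i, x.2 ▸ hi⟩ (treeBasis K z) h
    rw [map_sub, LinearMap.sub_apply, freeOperad_comp_treeBasis, freeOperad_comp_treeBasis]
      at hcomp
    exact treeCongr_iff.2 hcomp

end TreeCongr

end SyntaxTree

namespace RewriteRule

open Relation SyntaxTree

variable {G : Type v} {rule : BinaryTree G → BinaryTree G → Prop}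

theorem terminating_iff_wellFounded :
    Terminating rule ↔ WellFounded (flip (Step rule)) := by
  rw [wellFounded_iff_isEmpty_descending_chain, isEmpty_subtype, Terminating, not_exists]
  rfl

theorem inducedSpace_le {K : Type u} [Field K] {R : ∀ n, Submodule K ((freeOperad K G).obj n)}
    (h : ∀ s s', rule s s' → TreeCongr R s s') (n : ℕ) : inducedSpace K rule n ≤ R n := by
  refine Submodule.span_le.2 ?_
  rintro _ ⟨t, t', htt', rfl⟩
  exact treeCongr_iff.1 ((treeCongr_equivalence R).eqvGen_iff.1 (htt'.mono h))

section LiftInvariant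

variable {S : SetOperad.{w}} {γ : G → S.obj 1}

theorem join_of_lift_eq (hterm : Terminating rule)
    (hrule : ∀ s s', rule s s' → lift γ s = lift γ s')
    (hinj : Set.InjOn (lift γ) {t | IsNormalForm rule t}) {t s : BinaryTree G}
    (h : lift γ t = lift γ s) : Join (ReflTransGen (Step rule)) t s :=
  join_of_injOn_irreducible (terminating_iff_wellFounded.1 hterm)
    (fun _ _ => (isCongruence_lift γ).of_step hrule) hinj h

theorem lift_eq_of_reflTransGen (hrule : ∀ s s', rule s s' → lift γ s = lift γ s')
    {t s : BinaryTree G} (h : ReflTransGen (Step rule) t s) : lift γ t = lift γ s :=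
  reflTransGen_map_eq (F := lift γ) (fun _ _ => (isCongruence_lift γ).of_step hrule) h

theorem confluent_of_injOn_lift (hterm : Terminating rule)
    (hrule : ∀ s s', rule s s' → lift γ s = lift γ s')
    (hinj : Set.InjOn (lift γ) {t | IsNormalForm rule t}) : Confluent rule := by
  intro t r₁ r₂ h₁ h₂
  exact join_of_lift_eq hterm hrule hinj
    ((lift_eq_of_reflTransGen hrule h₁).symm.trans (lift_eq_of_reflTransGen hrule h₂))

variable (K : Type u) [Field K]

theorem generated_inducedSpace_eq_ker (hterm : Terminating rule)
    (hrule : ∀ s s', rule s s' → lift γ s = lift γ s')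
    (hinj : Set.InjOn (lift γ) {t | IsNormalForm rule t}) :
    NSOperad.OperadIdeal.generated (freeOperad K G) (inducedSpace K rule) =
      (freeOperadHom K γ).ker := by
  set I := NSOperad.OperadIdeal.generated (freeOperad K G) (inducedSpace K rule)
  have hlift {t s : BinaryTree G} (h : lift γ t = lift γ s) :
      TreeCongr (freeOperadHom K γ).ker.carrier t s := by
    obtain ⟨n, x, rfl⟩ := exists_synTree t
    let y : SynTree G n := ⟨s, ((isCongruence_lift γ).numLeaves_eq h).symm.trans x.2⟩
    rw [show s = y.1 from rfl, treeCongr_iff, freeOperadHom_ker_carrier]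
    exact Submodule.subset_span ⟨x, y, h, rfl⟩
  have hstep {t s : BinaryTree G} (h : Step rule t s) : TreeCongr I.carrier t s := by
    refine (isCongruence_treeCongr I).of_step (fun s s' hss' => ?_) h
    obtain ⟨n, x, y, rfl, rfl, -⟩ := hlift (hrule s s' hss')
    exact treeCongr_iff.2 (NSOperad.OperadIdeal.le_generated _ n
      (Submodule.subset_span ⟨x, y, .rel _ _ hss', rfl⟩))
  ext1
  funext n
  refine le_antisymm (NSOperad.OperadIdeal.generated_le (inducedSpace_le fun s s' hss' =>
    hlift (hrule s s' hss')) n) ?_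
  rw [freeOperadHom_ker_carrier, Submodule.span_le]
  rintro _ ⟨t, s, hts, rfl⟩
  exact treeCongr_iff.1 (join_le_of_equivalence_of_le (treeCongr_equivalence I.carrier)
    (reflTransGen_le_of_equivalence_of_le (treeCongr_equivalence I.carrier) fun _ _ => hstep)
    _ _ (join_of_lift_eq hterm hrule hinj hts))

end LiftInvariant
section NormalFormBasis

variable {S : SetOperad.{w}} {γ : G → S.obj 1} (K : Type u) [Field K]

theorem exists_basis_freeOperadHom_range (hterm : Terminating rule)
    (hrule : ∀ s s', rule s s' → lift γ s = lift γ s')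
    (hinj : Set.InjOn (lift γ) {t | IsNormalForm rule t}) (n : ℕ) :
    Nonempty (Module.Basis {t : BinaryTree G // t.numLeaves = n + 1 ∧ IsNormalForm rule t} K
      ((freeOperadHom K γ).range.carrier n)) := by
  let v (t : {t : BinaryTree G // t.numLeaves = n + 1 ∧ IsNormalForm rule t}) : S.obj n →₀ K :=
    S.basis K (liftAt γ (⟨t.1, t.2.1⟩ : SynTree G n))
  have linearIndependent_v : LinearIndependent K v := by
    refine (Finsupp.linearIndependent_single_one K (S.obj n)).comp _ fun t s hts => ?_
    exact Subtype.ext (hinj t.2.2 s.2.2 ((liftAt_eq_liftAt_iff γ).1 hts))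
  have range_v : Set.range v = Set.range fun t : SynTree G n => S.basis K (liftAt γ t) := by
    refine Set.Subset.antisymm (Set.range_subset_iff.2 fun t => ⟨⟨t.1, t.2.1⟩, rfl⟩)
      (Set.range_subset_iff.2 fun t => ?_)
    obtain ⟨s, hts, hs⟩ :=
      exists_reflTransGen_irreducible (terminating_iff_wellFounded.1 hterm) t.1
    have lift_eq : lift γ t.1 = lift γ s := lift_eq_of_reflTransGen hrule hts
    have hsn : s.numLeaves = n + 1 := ((isCongruence_lift γ).numLeaves_eq lift_eq).symm.trans t.2
    exact ⟨⟨s, hsn, hs⟩, congrArg (S.basis K) ((liftAt_eq_liftAt_iff γ).2 lift_eq.symm)⟩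
  have span_v : Submodule.span K (Set.range v) = (freeOperadHom K γ).range.carrier n :=
    (congrArg (Submodule.span K) range_v).trans (freeOperadHom_range_carrier K γ n).symm
  exact ⟨(Module.Basis.span linearIndependent_v).map (LinearEquiv.ofEq _ _ span_v)⟩

variable {K} {O : NSOperad.{u, w} K}

theorem normalFormSeries_eq_hilbertSeries
    (hO : ∀ n, Nonempty (Module.Basis
      {t : BinaryTree G // t.numLeaves = n + 1 ∧ IsNormalForm rule t} K (O.obj n))) :
    normalFormSeries rule = O.hilbertSeries := by
  ext n
  rw [normalFormSeries, NSOperad.hilbertSeries, PowerSeries.coeff_mk, PowerSeries.coeff_mk]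
  cases n with
  | zero =>
    have : IsEmpty {t : BinaryTree G // t.numLeaves = 0 ∧ IsNormalForm rule t} :=
      ⟨fun t => (numLeaves_pos t.1).ne' t.2.1⟩
    rw [Nat.card_of_isEmpty, if_pos rfl]
  | succ n =>
    rw [if_neg n.succ_ne_zero, Nat.add_sub_cancel,
      Module.finrank_eq_nat_card_basis (hO n).some]

theorem finite_normalForms [∀ n, Module.Finite K (O.obj n)]
    (hO : ∀ n, Nonempty (Module.Basis
      {t : BinaryTree G // t.numLeaves = n + 1 ∧ IsNormalForm rule t} K (O.obj n))) (n : ℕ) :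
    Finite {t : BinaryTree G // t.numLeaves = n ∧ IsNormalForm rule t} := by
  cases n with
  | zero =>
    have : IsEmpty {t : BinaryTree G // t.numLeaves = 0 ∧ IsNormalForm rule t} :=
      ⟨fun t => (numLeaves_pos t.1).ne' t.2.1⟩
    infer_instance
  | succ n => exact Module.Finite.finite_basis (hO n).some

end NormalFormBasis

theorem step_graftAll {s s' : BinaryTree G} (h : rule s s') (f : ℕ → BinaryTree G) :
    Step rule (graftAll s f) (graftAll s' f) :=
  ⟨.nil, 0, s, s', f, Nat.one_pos, h, rfl, rfl⟩

theorem Step.node_left {g : G} {a a' : BinaryTree G} (h : Step rule a a') (b : BinaryTree G) :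
    Step rule (.node g a b) (.node g a' b) := by
  obtain ⟨u, i, s, s', f, hi, hss', rfl, rfl⟩ := h
  have hi' : i < (BinaryTree.node g u b).numLeaves := by
    rw [BinaryTree.numLeaves]
    omega
  exact ⟨.node g u b, i, s, s', f, hi', hss', by rw [graft, if_pos hi], by rw [graft, if_pos hi]⟩

theorem Step.node_right {g : G} (a : BinaryTree G) {b b' : BinaryTree G} (h : Step rule b b') :
    Step rule (.node g a b) (.node g a b') := by
  obtain ⟨u, i, s, s', f, hi, hss', rfl, rfl⟩ := h
  have hi' : a.numLeaves + i < (BinaryTree.node g a u).numLeaves := by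
    rw [BinaryTree.numLeaves]
    omega
  have graft_eq (c : BinaryTree G) :
      graft (.node g a u) (a.numLeaves + i) c = .node g a (graft u i c) := by
    rw [graft, if_neg (by omega), Nat.add_sub_cancel_left]
  exact ⟨.node g a u, a.numLeaves + i, s, s', f, hi', hss', (graft_eq _).symm,
    (graft_eq _).symm⟩

theorem IsNormalForm.left {g : G} {a b : BinaryTree G} (h : IsNormalForm rule (.node g a b)) :
    IsNormalForm rule a :=
  fun _ ha => h _ (ha.node_left b)

theorem IsNormalForm.right {g : G} {a b : BinaryTree G} (h : IsNormalForm rule (.node g a b)) :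
    IsNormalForm rule b :=
  fun _ hb => h _ (hb.node_right a)

theorem IsNormalForm.not_rule_left_comb {p q : G} {a b c : BinaryTree G}
    (h : IsNormalForm rule (.node p (.node q a b) c)) (s : BinaryTree G) :
    ¬ rule (graft (corolla p) 0 (corolla q)) s :=
  fun hs => h _ (step_graftAll hs fun | 0 => a | 1 => b | _ => c)

theorem IsNormalForm.not_rule_right_comb {p q : G} {a b c : BinaryTree G}
    (h : IsNormalForm rule (.node p a (.node q b c))) (s : BinaryTree G) :
    ¬ rule (graft (corolla p) 1 (corolla q)) s :=
  fun hs => h _ (step_graftAll hs fun | 0 => a | 1 => b | _ => c)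

theorem Step.induction {motive : BinaryTree G → BinaryTree G → Prop}
    (root : ∀ s s' f, rule s s' → motive (graftAll s f) (graftAll s' f))
    (left : ∀ g a a' b, motive a a' → motive (.node g a b) (.node g a' b))
    (right : ∀ g a b b', motive b b' → motive (.node g a b) (.node g a b'))
    {t t' : BinaryTree G} (h : Step rule t t') : motive t t' := by
  obtain ⟨u, i, s, s', f, -, hss', rfl, rfl⟩ := h
  induction u generalizing i with
  | nil => exact root s s' f hss'
  | node g a b ha hb =>
    rw [graft, graft]
    split_ifs with hi
    · exact left _ _ _ _ (ha i)
    · exact right _ _ _ _ (hb _)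

theorem terminating_of_measure (w : BinaryTree G → ℕ)
    (hw : ∀ t t', Step rule t t' → w t' < w t) : Terminating rule :=
  terminating_iff_wellFounded.2
    (Subrelation.wf (fun {_ _} h => hw _ _ h) (InvImage.wf w Nat.lt_wfRel.wf))

end RewriteRule

/-! ## Cutting a clique along a triangle -/

section Cliques

variable {M : Type v} [MulOneClass M] {n m k : ℕ}

namespace Triangle

theorem lab_mk_base (a b c : M) : (mk a b c).lab 1 3 = a := rfl

theorem lab_mk_fst (a b c : M) : (mk a b c).lab 1 2 = b := rfl

theorem lab_mk_snd (a b c : M) : (mk a b c).lab 2 3 = c := rfl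

theorem mk_lab (g : Triangle M) : mk (g.lab 1 3) (g.lab 1 2) (g.lab 2 3) = g := by
  apply Clique.ext_lab
  intro x y h₁ h₂ h₃
  obtain ⟨rfl, rfl⟩ | ⟨rfl, rfl⟩ | ⟨rfl, rfl⟩ :
    x = 1 ∧ y = 3 ∨ x = 1 ∧ y = 2 ∨ x = 2 ∧ y = 3 := by omega
  all_goals rfl

end Triangle

namespace Clique

theorem ext_of_four_vertices {p q : Clique M (1 + 1)} (h₁₂ : p.lab 1 2 = q.lab 1 2)
    (h₁₃ : p.lab 1 3 = q.lab 1 3) (h₁₄ : p.lab 1 4 = q.lab 1 4) (h₂₃ : p.lab 2 3 = q.lab 2 3)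
    (h₂₄ : p.lab 2 4 = q.lab 2 4) (h₃₄ : p.lab 3 4 = q.lab 3 4) : p = q := by
  apply ext_lab
  intro x y hx hxy hy
  have hx' : x ≤ 3 := by omega
  have hy' : y ≤ 4 := hy
  interval_cases x <;> interval_cases y <;> assumption

theorem comp_zero_triangle (p₀ p₁ p₂ q₀ q₁ q₂ : M) :
    comp 0 (Triangle.mk p₀ p₁ p₂) (Triangle.mk q₀ q₁ q₂) =
      comp 0 (Triangle.mk p₀ (p₁ * q₀) p₂) (Triangle.mk 1 q₁ q₂) :=
  ext_of_four_vertices rfl (mul_one _).symm rfl rfl rfl rfl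

theorem comp_one_triangle (p₀ p₁ p₂ q₀ q₁ q₂ : M) :
    comp 1 (Triangle.mk p₀ p₁ p₂) (Triangle.mk q₀ q₁ q₂) =
      comp 1 (Triangle.mk p₀ p₁ (p₂ * q₀)) (Triangle.mk 1 q₁ q₂) :=
  ext_of_four_vertices rfl rfl rfl rfl (mul_one _).symm rfl

theorem comp_zero_triangle_eq_comp_one (p₀ p₁ p₂ q₀ q₁ q₂ : M) (h : p₁ * q₀ = 1) :
    comp 0 (Triangle.mk p₀ p₁ p₂) (Triangle.mk q₀ q₁ q₂) =
      comp 1 (Triangle.mk p₀ q₁ 1) (Triangle.mk 1 q₂ p₂) :=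
  ext_of_four_vertices rfl h rfl rfl (mul_one _).symm rfl

/-- The clique obtained by gluing the base of `p` onto the first edge, and the base of `q` onto
the second edge, of a triangle. -/
def glue (g : Triangle M) (p : Clique M k) (q : Clique M m) : Clique M (1 + m + k) :=
  comp 0 (comp 1 g q) p

theorem lab_glue (g : Triangle M) (p : Clique M k) (q : Clique M m) {x y : ℕ} (hx : 1 ≤ x)
    (hxy : x < y) (hy : y ≤ k + m + 3) :
    (glue g p q).lab x y =
      if y ≤ k + 2 then
        if x = 1 ∧ y = k + 2 then g.lab 1 2 * p.lab 1 (k + 2) else p.lab x y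
      else if k + 2 ≤ x then
        if x = k + 2 ∧ y = k + m + 3 then g.lab 2 3 * q.lab 1 (m + 2)
        else q.lab (x - (k + 1)) (y - (k + 1))
      else if x = 1 ∧ y = k + m + 3 then g.lab 1 3 else 1 := by
  rw [glue, lab_comp _ _ _ _ _ (by omega),
    compLab_comp_left _ _ _ _ _ hx hxy (by omega) (by simp) (by simp)]
  unfold compLab
  simp only [Fin.coe_ofNat_eq_mod, Nat.zero_mod, zero_add, Nat.reduceAdd, Fin.isValue,
    Nat.mod_succ, not_and, tsub_le_iff_right, Std.le_refl, ↓reduceIte]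
  grind (splits := 40)

/-- The clique on the vertices `k + 1, …, k + n + 2` of `p`, with base relabeled by the unit. -/
def restrict (p : Clique M m) (k n : ℕ) : Clique M n where
  label a := if a.1 = (1, n + 2) then 1 else p.lab (a.1.1 + k) (a.1.2 + k)
  label_of_size_one := by
    rintro rfl ⟨⟨x, y⟩, h⟩
    refine if_pos (Prod.ext ?_ ?_) <;> dsimp only at h ⊢ <;> omega

theorem lab_restrict_base (p : Clique M m) (k n : ℕ) : (restrict p k n).lab 1 (n + 2) = 1 := by
  rw [lab, dif_pos (by omega)]
  exact if_pos rfl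

theorem lab_restrict (p : Clique M m) (k n : ℕ) {x y : ℕ} (hx : 1 ≤ x) (hxy : x < y)
    (hy : y ≤ n + 2) (h : ¬(x = 1 ∧ y = n + 2)) :
    (restrict p k n).lab x y = p.lab (x + k) (y + k) := by
  rw [lab, dif_pos ⟨hx, hxy, hy⟩]
  exact if_neg fun hxy => h (Prod.ext_iff.1 hxy)

theorem Noncrossing.restrict {p : Clique M m} (hp : p.Noncrossing) (k n : ℕ) :
    (restrict p k n).Noncrossing := by
  have isArc {x y : ℕ} (h : (Clique.restrict p k n).lab x y ≠ 1) :
      1 ≤ x ∧ x < y ∧ y ≤ n + 2 := not_not.1 (mt (lab_outside _) h)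
  refine Noncrossing.wlog fun x y x' y' h₁ h₂ h₃ h h' => ?_
  have a := isArc h
  have a' := isArc h'
  rw [lab_restrict _ _ _ (by omega) (by omega) (by omega) (by omega)] at h h'
  exact h' (hp.elim (by omega) (by omega) (by omega) h)

theorem eq_glue (p : Clique M (1 + m + k))
    (hp : ∀ x y, x < k + 2 → k + 2 < y → ¬(x = 1 ∧ y = 1 + m + k + 2) → p.lab x y = 1) :
    p = glue (Triangle.mk (p.lab 1 (1 + m + k + 2)) (p.lab 1 (k + 2)) (p.lab (k + 2) (k + m + 3)))
      (p.restrict 0 k) (p.restrict (k + 1) m) := by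
  apply ext_lab
  intro x y hx hxy hy
  rw [lab_glue _ _ _ hx hxy (by omega), Triangle.lab_mk_base, Triangle.lab_mk_fst,
    Triangle.lab_mk_snd, lab_restrict_base, lab_restrict_base, mul_one, mul_one]
  split_ifs with h₁ h₂ h₃ h₄ h₅
  · rw [h₂.1, h₂.2]
  · rw [lab_restrict _ _ _ hx hxy h₁ h₂, add_zero, add_zero]
  · rw [h₄.1, h₄.2]
  · rw [lab_restrict _ _ _ (by omega) (by omega) (by omega) (by omega),
      Nat.sub_add_cancel (by omega), Nat.sub_add_cancel (by omega)]
  · rw [h₅.1, h₅.2, show k + m + 3 = 1 + m + k + 2 by omega]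
  · exact hp x y (by omega) (by omega) (by omega)

open Classical in
/-- If `k` is the apex of a clique with at least two edges, the vertex `k + 2` is the last one
joined to the vertex `1` by a solid arc other than the base, and the vertex `2` if there is none.
A noncrossing clique is cut into two along the triangle on `1`, `k + 2` and the last vertex. -/
noncomputable def apex (p : Clique M n) : ℕ :=
  Nat.findGreatest (fun k => p.lab 1 (k + 2) ≠ 1) (n - 1)

theorem apex_le (p : Clique M n) : p.apex ≤ n - 1 := by
  classical exact Nat.findGreatest_le _

theorem Noncrossing.lab_eq_one_of_lt_apex_of_apex_lt {p : Clique M n} (hp : p.Noncrossing)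
    {x y : ℕ} (hx : x < p.apex + 2) (hy : p.apex + 2 < y) (hxy : ¬(x = 1 ∧ y = n + 2)) :
    p.lab x y = 1 := by
  classical
  by_contra h
  have isArc : 1 ≤ x ∧ x < y ∧ y ≤ n + 2 := not_not.1 (mt p.lab_outside h)
  obtain rfl | hx₁ := isArc.1.eq_or_lt
  · refine Nat.findGreatest_is_greatest (P := fun k => p.lab 1 (k + 2) ≠ 1) (k := y - 2)
      (show p.apex < y - 2 by omega) (by omega) ?_
    rwa [Nat.sub_add_cancel (by omega)]
  · have apex_solid : p.lab 1 (p.apex + 2) ≠ 1 :=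
      Nat.findGreatest_of_ne_zero (P := fun k => p.lab 1 (k + 2) ≠ 1) rfl (by omega)
    exact h (hp.elim hx₁ hx hy apex_solid)

/-- A triangle and two cliques glued on its edges are reduced when their common arcs carry their
labels on the triangle, and the first of these arcs is solid as soon as it is a diagonal. -/
structure IsReduced (g : Triangle M) (p : Clique M k) (q : Clique M m) : Prop where
  left_base : p.lab 1 (k + 2) = 1
  right_base : q.lab 1 (m + 2) = 1
  fst_ne_one : k ≠ 0 → g.lab 1 2 ≠ 1

theorem IsReduced.apex_glue {g : Triangle M} {p : Clique M k} {q : Clique M m}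
    (h : IsReduced g p q) : (glue g p q).apex = k := by
  classical
  refine Nat.findGreatest_eq_iff.2 ⟨by omega, fun hk => ?_, fun l hkl hl => ?_⟩
  · rw [lab_glue _ _ _ (by omega) (by omega) (by omega), if_pos le_rfl, if_pos ⟨rfl, rfl⟩,
      h.left_base, mul_one]
    exact h.fst_ne_one hk
  · rw [not_not, lab_glue _ _ _ (by omega) (by omega) (by omega), if_neg (by omega),
      if_neg (by omega), if_neg (by omega)]

theorem IsReduced.restrict_left {g : Triangle M} {p : Clique M k} {q : Clique M m}
    (h : IsReduced g p q) : (glue g p q).restrict 0 k = p := by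
  apply ext_lab
  intro x y hx hxy hy
  by_cases hb : x = 1 ∧ y = k + 2
  · rw [hb.1, hb.2, lab_restrict_base, h.left_base]
  · rw [lab_restrict _ _ _ hx hxy hy hb, add_zero, add_zero, lab_glue _ _ _ hx hxy (by omega),
      if_pos hy, if_neg hb]

theorem IsReduced.restrict_right {g : Triangle M} {p : Clique M k} {q : Clique M m}
    (h : IsReduced g p q) : (glue g p q).restrict (k + 1) m = q := by
  apply ext_lab
  intro x y hx hxy hy
  by_cases hb : x = 1 ∧ y = m + 2
  · rw [hb.1, hb.2, lab_restrict_base, h.right_base]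
  · rw [lab_restrict _ _ _ hx hxy hy hb, lab_glue _ _ _ (by omega) (by omega) (by omega),
      if_neg (by omega), if_pos (by omega), if_neg (by omega), Nat.add_sub_cancel,
      Nat.add_sub_cancel]

theorem lab_glue_base (g : Triangle M) (p : Clique M k) (q : Clique M m) :
    (glue g p q).lab 1 (1 + m + k + 2) = g.lab 1 3 := by
  rw [lab_glue _ _ _ le_rfl (by omega) (by omega), if_neg (by omega), if_neg (by omega),
    if_pos (by omega)]

theorem IsReduced.mk_lab_glue {g : Triangle M} {p : Clique M k} {q : Clique M m}
    (h : IsReduced g p q) :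
    Triangle.mk ((glue g p q).lab 1 (1 + m + k + 2)) ((glue g p q).lab 1 (k + 2))
      ((glue g p q).lab (k + 2) (k + m + 3)) = g := by
  rw [lab_glue_base, lab_glue _ _ _ le_rfl (by omega) (by omega), if_pos le_rfl,
    if_pos ⟨rfl, rfl⟩, lab_glue _ _ _ (by omega) (by omega) le_rfl, if_neg (by omega),
    if_pos le_rfl, if_pos ⟨rfl, rfl⟩, h.left_base, h.right_base, mul_one, mul_one, Triangle.mk_lab]

theorem IsReduced.eq_of_glue_eq {k' m' : ℕ} {g g' : Triangle M} {p : Clique M k} {q : Clique M m}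
    {p' : Clique M k'} {q' : Clique M m'} (h : IsReduced g p q) (h' : IsReduced g' p' q')
    (heq : (⟨1 + m + k, glue g p q⟩ : (setOperad M).Total) = ⟨1 + m' + k', glue g' p' q'⟩) :
    g = g' ∧ (⟨k, p⟩ : (setOperad M).Total) = ⟨k', p'⟩ ∧
      (⟨m, q⟩ : (setOperad M).Total) = ⟨m', q'⟩ := by
  obtain rfl : k = k' := by
    rw [← h.apex_glue, ← h'.apex_glue]
    exact congrArg (fun c : (setOperad M).Total => apex c.2) heq
  obtain rfl : m = m' := by
    have := congrArg Sigma.fst heq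
    dsimp only at this
    omega
  have glue_eq : glue g p q = glue g' p' q' := eq_of_heq (Sigma.mk.inj heq).2
  refine ⟨?_, ?_, ?_⟩
  · rw [← h.mk_lab_glue, ← h'.mk_lab_glue, glue_eq]
  · rw [← h.restrict_left, ← h'.restrict_left, glue_eq]
  · rw [← h.restrict_right, ← h'.restrict_right, glue_eq]

end Clique

end Cliques

section Evaluation

open SyntaxTree

variable {M : Type v} [MulOneClass M]

/-- The triangles as binary operations of the set-operad of cliques, in which syntax trees on
triangles are evaluated. -/
abbrev Triangle.toClique : Triangle M → (Clique.setOperad M).obj 1 := id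

theorem lift_toClique_node (g : Triangle M) (a b : BinaryTree (Triangle M)) :
    lift Triangle.toClique (.node g a b) =
      ⟨1 + (lift Triangle.toClique b).1 + (lift Triangle.toClique a).1,
        Clique.glue g (lift Triangle.toClique a).2 (lift Triangle.toClique b).2⟩ := by
  rw [lift, SetOperad.Total.comp_of_lt (i := 1) Nat.one_lt_two, SetOperad.Total.comp_of_lt]
  rfl

theorem lift_graft_corolla_corolla {i : ℕ} (hi : i < 1 + 1) (p q : Triangle M) :
    lift Triangle.toClique (graft (corolla p) i (corolla q)) =
      ⟨1 + 1, Clique.comp ⟨i, hi⟩ p q⟩ := by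
  rw [lift_graft _ _ _ hi, lift_corolla, lift_corolla, SetOperad.Total.comp_of_lt hi]
  rfl

theorem NCRule.lift_eq {s s' : BinaryTree (Triangle M)} (h : NCRule M s s') :
    lift Triangle.toClique s = lift Triangle.toClique s' := by
  cases h with
  | rule1 p₀ p₁ p₂ q₀ q₁ q₂ h =>
    rw [lift_graft_corolla_corolla Nat.two_pos, lift_graft_corolla_corolla Nat.two_pos]
    exact congrArg (Sigma.mk (1 + 1)) (Clique.comp_zero_triangle p₀ p₁ p₂ q₀ q₁ q₂)
  | rule2 p₀ p₁ p₂ q₀ q₁ q₂ h =>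
    rw [lift_graft_corolla_corolla Nat.two_pos, lift_graft_corolla_corolla Nat.one_lt_two]
    exact congrArg (Sigma.mk (1 + 1))
      (Clique.comp_zero_triangle_eq_comp_one p₀ p₁ p₂ q₀ q₁ q₂ h)
  | rule3 p₀ p₁ p₂ q₀ q₁ q₂ h =>
    rw [lift_graft_corolla_corolla Nat.one_lt_two, lift_graft_corolla_corolla Nat.one_lt_two]
    exact congrArg (Sigma.mk (1 + 1)) (Clique.comp_one_triangle p₀ p₁ p₂ q₀ q₁ q₂)

theorem noncrossing_lift (t : BinaryTree (Triangle M)) :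
    Clique.Noncrossing (lift Triangle.toClique t).2 := by
  induction t with
  | nil => exact Clique.noncrossing_of_size_le_two _ (Nat.zero_le 1)
  | node g a b ha hb =>
    rw [lift_toClique_node]
    exact (((g.noncrossing_of_size_le_two le_rfl).comp hb 1).comp ha 0)

theorem exists_lift_eq {n : ℕ} {p : Clique M n} (hp : p.Noncrossing) :
    ∃ t : BinaryTree (Triangle M), lift Triangle.toClique t = ⟨n, p⟩ := by
  induction n using Nat.strong_induction_on with
  | _ n ih =>
    obtain rfl | hn := n.eq_zero_or_pos
    · exact ⟨.nil, congrArg (Sigma.mk 0) (Clique.ext_lab fun x y _ _ _ =>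
        (Clique.lab_size_one _ x y).trans (Clique.lab_size_one p x y).symm)⟩
    · obtain ⟨k, hk⟩ : ∃ k, p.apex = k := ⟨_, rfl⟩
      obtain ⟨m, rfl⟩ : ∃ m, n = 1 + m + k := ⟨n - 1 - k, by have := p.apex_le; omega⟩
      obtain ⟨a, ha⟩ := ih k (by omega) (hp.restrict 0 k)
      obtain ⟨b, hb⟩ := ih m (by omega) (hp.restrict (k + 1) m)
      refine ⟨.node (Triangle.mk (p.lab 1 (1 + m + k + 2)) (p.lab 1 (k + 2))
        (p.lab (k + 2) (k + m + 3))) a b, ?_⟩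
      rw [lift_toClique_node, ha, hb]
      refine congrArg (Sigma.mk (1 + m + k)) (p.eq_glue fun x y hx hy hxy => ?_).symm
      exact hp.lab_eq_one_of_lt_apex_of_apex_lt (by omega) (by omega) (by omega)

end Evaluation

section NormalForms

open SyntaxTree RewriteRule

variable {M : Type v} [MulOneClass M] {g g' : Triangle M} {a b c : BinaryTree (Triangle M)}

theorem lab_base_lift_node (g : Triangle M) (a b : BinaryTree (Triangle M)) :
    Clique.lab (lift Triangle.toClique (.node g a b)).2 1
      ((lift Triangle.toClique (.node g a b)).1 + 2) = g.lab 1 3 := by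
  rw [lift_toClique_node]
  exact Clique.lab_glue_base g _ _

theorem NCRule.base_eq_one_left
    (h : IsNormalForm (NCRule M) (.node g (.node g' a b) c)) : g'.lab 1 3 = 1 := by
  by_contra hg'
  rw [← g.mk_lab, ← g'.mk_lab] at h
  exact h.not_rule_left_comb _ (.rule1 _ _ _ _ _ _ hg')

theorem NCRule.base_eq_one_right
    (h : IsNormalForm (NCRule M) (.node g a (.node g' b c))) : g'.lab 1 3 = 1 := by
  by_contra hg'
  rw [← g.mk_lab, ← g'.mk_lab] at h
  exact h.not_rule_right_comb _ (.rule3 _ _ _ _ _ _ hg')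

theorem NCRule.fst_ne_one
    (h : IsNormalForm (NCRule M) (.node g (.node g' a b) c)) : g.lab 1 2 ≠ 1 := by
  intro hg
  have hmul : g.lab 1 2 * g'.lab 1 3 = 1 := by rw [hg, base_eq_one_left h, one_mul]
  rw [← g.mk_lab, ← g'.mk_lab] at h
  exact h.not_rule_left_comb _ (.rule2 _ _ _ _ _ _ hmul)

theorem isReduced_of_isNormalForm_node (h : IsNormalForm (NCRule M) (.node g a b)) :
    Clique.IsReduced g (lift Triangle.toClique a).2 (lift Triangle.toClique b).2 where
  left_base := by
    cases a with
    | nil => exact Clique.lab_size_one _ _ _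
    | node g' a₁ a₂ => exact (lab_base_lift_node g' a₁ a₂).trans (NCRule.base_eq_one_left h)
  right_base := by
    cases b with
    | nil => exact Clique.lab_size_one _ _ _
    | node g' b₁ b₂ => exact (lab_base_lift_node g' b₁ b₂).trans (NCRule.base_eq_one_right h)
  fst_ne_one ha := by
    cases a with
    | nil => exact absurd rfl ha
    | node g' a₁ a₂ => exact NCRule.fst_ne_one h

theorem injOn_lift_isNormalForm :
    Set.InjOn (lift (Triangle.toClique (M := M))) {t | IsNormalForm (NCRule M) t} := by
  intro t ht t' ht' heq
  induction t generalizing t' with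
  | nil =>
    cases t' with
    | nil => rfl
    | node g' a' b' => exact absurd heq.symm (lift_node_ne_lift_nil _ g' a' b')
  | node g a b iha ihb =>
    cases t' with
    | nil => exact absurd heq (lift_node_ne_lift_nil _ g a b)
    | node g' a' b' =>
      rw [lift_toClique_node, lift_toClique_node] at heq
      obtain ⟨rfl, ha, hb⟩ := (isReduced_of_isNormalForm_node ht).eq_of_glue_eq
        (isReduced_of_isNormalForm_node ht') heq
      rw [iha ht.left ht'.left ha, ihb ht.right ht'.right hb]

/-- The measure showing that `NCRule` terminates: it counts each internal node with a solid base
once, and each node once for every ancestor of which it lies in the left subtree. The first and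
third rules erase a solid base, and the second one moves a node from left to right. -/
noncomputable def ncWeight : BinaryTree (Triangle M) → ℕ
  | .nil => 0
  | .node g a b => ({1}ᶜ : Set M).indicator 1 (g.lab 1 3) + a.numNodes + ncWeight a + ncWeight b

theorem NCRule.ncWeight_graftAll_lt {s s' : BinaryTree (Triangle M)} (h : NCRule M s s')
    (f : ℕ → BinaryTree (Triangle M)) :
    (graftAll s f).numNodes = (graftAll s' f).numNodes ∧
      ncWeight (graftAll s' f) < ncWeight (graftAll s f) := by
  have solid_one : ({1}ᶜ : Set M).indicator (1 : M → ℕ) 1 = 0 :=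
    Set.indicator_of_notMem (Set.notMem_compl_iff.2 rfl) _
  have solid_of_ne {x : M} (hx : x ≠ 1) : ({1}ᶜ : Set M).indicator (1 : M → ℕ) x = 1 :=
    Set.indicator_of_mem hx _
  cases h with
  | rule1 p₀ p₁ p₂ q₀ q₁ q₂ hq =>
    simp only [graftAll_left_comb, ncWeight, BinaryTree.numNodes, Triangle.lab_mk_base,
      solid_one, solid_of_ne hq, true_and]
    omega
  | rule2 p₀ p₁ p₂ q₀ q₁ q₂ hpq =>
    simp only [graftAll_left_comb, graftAll_right_comb, ncWeight, BinaryTree.numNodes,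
      Triangle.lab_mk_base, solid_one]
    omega
  | rule3 p₀ p₁ p₂ q₀ q₁ q₂ hq =>
    simp only [graftAll_right_comb, ncWeight, BinaryTree.numNodes, Triangle.lab_mk_base,
      solid_one, solid_of_ne hq, true_and]
    omega

theorem terminating_ncRule : Terminating (NCRule M) := by
  let decreases (t t' : BinaryTree (Triangle M)) : Prop :=
    t.numNodes = t'.numNodes ∧ ncWeight t' < ncWeight t
  refine terminating_of_measure ncWeight fun t t' h => ?_
  suffices decreases t t' from this.2
  refine h.induction (fun _ _ f h => h.ncWeight_graftAll_lt f) ?_ ?_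
  · rintro g a a' b ⟨hn, hw⟩
    refine ⟨?_, ?_⟩ <;> simp only [BinaryTree.numNodes, ncWeight] <;> omega
  · rintro g a b b' ⟨hn, hw⟩
    refine ⟨?_, ?_⟩ <;> simp only [BinaryTree.numNodes, ncWeight] <;> omega

end NormalForms

/-! ## Relations between triangles -/

section Relations

open Relation SyntaxTree RewriteRule

variable (K : Type u) [Field K]

theorem comp_freeCorolla_freeCorolla {G : Type v} (i : Fin 2) (p q : G) :
    (freeOperad K G).comp i (freeCorolla K p) (freeCorolla K q) =
      treeBasis K (⟨graft (corolla p) i (corolla q), by fin_cases i <;> rfl⟩ :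
        SynTree G (1 + 1)) :=
  freeOperad_comp_treeBasis i _ _

variable {K} in
theorem treeCongr_of_comp_sub_comp_mem {G : Type v}
    {R : ∀ n, Submodule K ((freeOperad K G).obj n)} (i j : Fin 2) {p q p' q' : G}
    (h : (freeOperad K G).comp i (freeCorolla K p) (freeCorolla K q) -
      (freeOperad K G).comp j (freeCorolla K p') (freeCorolla K q') ∈ R (1 + 1)) :
    TreeCongr R (graft (corolla p) i (corolla q)) (graft (corolla p') j (corolla q')) := by
  rw [comp_freeCorolla_freeCorolla, comp_freeCorolla_freeCorolla] at h
  exact treeCongr_iff.2 h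

variable {M : Type v} [MulOneClass M]

theorem NCRule.eqvGen_left (p₀ a p₂ b q₁ q₂ : M) :
    EqvGen (NCRule M)
      (graft (corolla (Triangle.mk p₀ a p₂)) 0 (corolla (Triangle.mk b q₁ q₂)))
      (graft (corolla (Triangle.mk p₀ (a * b) p₂)) 0 (corolla (Triangle.mk 1 q₁ q₂))) := by
  by_cases hb : b = 1
  · rw [hb, mul_one]
    exact .refl _
  · exact .rel _ _ (.rule1 _ _ _ _ _ _ hb)

theorem NCRule.eqvGen_right (p₀ p₁ a b q₁ q₂ : M) :
    EqvGen (NCRule M)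
      (graft (corolla (Triangle.mk p₀ p₁ a)) 1 (corolla (Triangle.mk b q₁ q₂)))
      (graft (corolla (Triangle.mk p₀ p₁ (a * b))) 1 (corolla (Triangle.mk 1 q₁ q₂))) := by
  by_cases hb : b = 1
  · rw [hb, mul_one]
    exact .refl _
  · exact .rel _ _ (.rule3 _ _ _ _ _ _ hb)

variable {K} in
theorem NCRelation.exists_eq_treeBasis_sub {n : ℕ} {x : (freeOperad K (Triangle M)).obj n}
    (hx : NCRelation K M n x) :
    ∃ t s : SynTree (Triangle M) n, t.1.numNodes = 2 ∧ s.1.numNodes = 2 ∧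
      EqvGen (NCRule M) t.1 s.1 ∧ x = treeBasis K t - treeBasis K s := by
  cases hx with
  | rel1 p₀ p₁ p₂ q₀ q₁ q₂ r₀ r₁ h h' =>
    refine ⟨_, _, rfl, rfl, ?_, congrArg₂ _ (comp_freeCorolla_freeCorolla K 0 _ _)
      (comp_freeCorolla_freeCorolla K 0 _ _)⟩
    exact (NCRule.eqvGen_left p₀ p₁ p₂ q₀ q₁ q₂).trans _ _ _
      (h ▸ (NCRule.eqvGen_left p₀ r₁ p₂ r₀ q₁ q₂).symm _ _)
  | rel2 p₀ p₁ p₂ q₀ q₁ q₂ r₀ r₂ h h' =>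
    refine ⟨_, _, rfl, rfl, ?_, congrArg₂ _ (comp_freeCorolla_freeCorolla K 0 _ _)
      (comp_freeCorolla_freeCorolla K 1 _ _)⟩
    exact (EqvGen.rel _ _ (NCRule.rule2 p₀ p₁ p₂ q₀ q₁ q₂ h)).trans _ _ _
      (h' ▸ (NCRule.eqvGen_right p₀ q₁ r₂ r₀ q₂ p₂).symm _ _)
  | rel3 p₀ p₁ p₂ q₀ q₁ q₂ r₀ r₂ h h' =>
    refine ⟨_, _, rfl, rfl, ?_, congrArg₂ _ (comp_freeCorolla_freeCorolla K 1 _ _)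
      (comp_freeCorolla_freeCorolla K 1 _ _)⟩
    exact (NCRule.eqvGen_right p₀ p₁ p₂ q₀ q₁ q₂).trans _ _ _
      (h ▸ (NCRule.eqvGen_right p₀ p₁ r₂ r₀ q₁ q₂).symm _ _)

theorem isQuadratic_ncRelations : IsQuadratic (ncRelations K M) := by
  refine fun n => Submodule.span_le.2 fun x hx => ?_
  obtain ⟨t, s, ht, hs, -, rfl⟩ := NCRelation.exists_eq_treeBasis_sub hx
  exact sub_mem (Submodule.subset_span ⟨t, ht, rfl⟩) (Submodule.subset_span ⟨s, hs, rfl⟩)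

-- If the common product is `1`, the two trees are related by `rel2` to the same right comb.
theorem comp_zero_sub_comp_zero_mem_ncRelations {p₀ p₁ p₂ q₀ q₁ q₂ r₀ r₁ : M}
    (h : p₁ * q₀ = r₁ * r₀) :
    (freeOperad K (Triangle M)).comp 0 (triCorolla K p₀ p₁ p₂) (triCorolla K q₀ q₁ q₂) -
      (freeOperad K (Triangle M)).comp 0 (triCorolla K p₀ r₁ p₂) (triCorolla K r₀ q₁ q₂) ∈
      ncRelations K M (1 + 1) := by
  by_cases hr : r₁ * r₀ = 1
  · rw [← sub_sub_sub_cancel_right _ _ ((freeOperad K (Triangle M)).comp 1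
      (triCorolla K p₀ q₁ 1) (triCorolla K 1 q₂ p₂))]
    exact sub_mem
      (Submodule.subset_span (.rel2 p₀ p₁ p₂ q₀ q₁ q₂ 1 1 (h.trans hr) (one_mul 1)))
      (Submodule.subset_span (.rel2 p₀ r₁ p₂ r₀ q₁ q₂ 1 1 hr (one_mul 1)))
  · exact Submodule.subset_span (.rel1 _ _ _ _ _ _ _ _ h hr)

-- If the common product is `1`, the two trees are related by `rel2` to the same left comb.
theorem comp_one_sub_comp_one_mem_ncRelations {p₀ p₁ p₂ q₀ q₁ q₂ r₀ r₂ : M}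
    (h : p₂ * q₀ = r₂ * r₀) :
    (freeOperad K (Triangle M)).comp 1 (triCorolla K p₀ p₁ p₂) (triCorolla K q₀ q₁ q₂) -
      (freeOperad K (Triangle M)).comp 1 (triCorolla K p₀ p₁ r₂) (triCorolla K r₀ q₁ q₂) ∈
      ncRelations K M (1 + 1) := by
  by_cases hr : r₂ * r₀ = 1
  · rw [← sub_sub_sub_cancel_left _ _ ((freeOperad K (Triangle M)).comp 0
      (triCorolla K p₀ 1 q₂) (triCorolla K 1 p₁ q₁))]
    exact sub_mem
      (Submodule.subset_span (.rel2 p₀ 1 q₂ 1 p₁ q₁ r₀ r₂ (one_mul 1) hr))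
      (Submodule.subset_span (.rel2 p₀ 1 q₂ 1 p₁ q₁ q₀ p₂ (one_mul 1) (h.trans hr)))
  · exact Submodule.subset_span (.rel3 _ _ _ _ _ _ _ _ h hr)

theorem NCRule.treeCongr {s s' : BinaryTree (Triangle M)} (h : NCRule M s s') :
    TreeCongr (ncRelations K M) s s' := by
  cases h with
  | rule1 p₀ p₁ p₂ q₀ q₁ q₂ =>
    exact treeCongr_of_comp_sub_comp_mem 0 0
      (comp_zero_sub_comp_zero_mem_ncRelations K (mul_one _).symm)
  | rule2 p₀ p₁ p₂ q₀ q₁ q₂ h =>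
    exact treeCongr_of_comp_sub_comp_mem 0 1
      (Submodule.subset_span (.rel2 p₀ p₁ p₂ q₀ q₁ q₂ 1 1 h (one_mul 1)))
  | rule3 p₀ p₁ p₂ q₀ q₁ q₂ =>
    exact treeCongr_of_comp_sub_comp_mem 1 1
      (comp_one_sub_comp_one_mem_ncRelations K (mul_one _).symm)

theorem inducedSpace_ncRule : inducedSpace K (NCRule M) = ncRelations K M := by
  funext n
  refine le_antisymm (inducedSpace_le (fun _ _ => NCRule.treeCongr K) n)
    (Submodule.span_le.2 fun x hx => ?_)
  obtain ⟨t, s, -, -, hts, rfl⟩ := NCRelation.exists_eq_treeBasis_sub hx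
  exact Submodule.subset_span ⟨t, s, hts, rfl⟩

end Relations

section Generation

open SyntaxTree

variable (K : Type u) [Field K] (M : Type v) [MulOneClass M]

theorem freeOperadHom_toClique_range :
    (freeOperadHom K (Triangle.toClique (M := M))).range = ncSuboperad K M := by
  ext1
  funext n
  refine (freeOperadHom_range_carrier K _ n).trans
    (congrArg (Submodule.span K) (Set.Subset.antisymm ?_ ?_))
  · rintro _ ⟨t, rfl⟩
    have noncrossing_iff := congrArg (fun x : (Clique.setOperad M).Total => Clique.Noncrossing x.2)
      (sigma_mk_liftAt Triangle.toClique t)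
    exact ⟨_, noncrossing_iff.mpr (noncrossing_lift t.1), rfl⟩
  · rintro _ ⟨p, hp, rfl⟩
    obtain ⟨t, ht⟩ := exists_lift_eq hp
    have hn : t.numLeaves = n + 1 := by rw [← lift_fst_add_one Triangle.toClique, ht]
    exact ⟨⟨t, hn⟩, congrArg (cliqueBasis K)
      ((liftAt_eq_iff Triangle.toClique (⟨t, hn⟩ : SynTree _ n) p).2 ht)⟩

theorem generated_triangleSet :
    NSOperad.Suboperad.generated (cliqueOperad K M) (triangleSet K M) = ncSuboperad K M := by
  ext1
  funext n
  refine le_antisymm (NSOperad.Suboperad.generated_le ?_ n) ?_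
  · rintro _ _ ⟨rfl, p, rfl⟩
    exact Submodule.subset_span ⟨p, Clique.noncrossing_of_size_le_two p le_rfl, rfl⟩
  · rw [← freeOperadHom_toClique_range]
    refine NSOperad.Hom.range_le_of_freeCorolla_mem _ (fun p => ?_) n
    exact NSOperad.Suboperad.subset_generated _ 1
      ⟨rfl, p, freeOperadHom_freeCorolla K Triangle.toClique p⟩

end Generation

section Finiteness

variable {M : Type v} [MulOneClass M]

instance Arc.finite (n : ℕ) : Finite (Arc n) :=
  Finite.of_injective (β := Fin (n + 3) × Fin (n + 3))
    (fun a => (⟨a.1.1, by have := a.2; omega⟩, ⟨a.1.2, by have := a.2; omega⟩))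
    fun a b h => by
      simp only [Prod.mk.injEq, Fin.mk.injEq] at h
      exact Subtype.ext (Prod.ext h.1 h.2)

instance Clique.finite [Finite M] (n : ℕ) : Finite (Clique M n) :=
  Finite.of_injective Clique.label fun _ _ => Clique.ext

instance finite_ncOperad_obj (K : Type u) [Field K] [Finite M] (n : ℕ) :
    Module.Finite K ((ncOperad K M).obj n) :=
  have : Module.Finite K ((cliqueOperad K M).obj n) :=
    inferInstanceAs (Module.Finite K (Clique M n →₀ K))
  inferInstanceAs (Module.Finite K ((ncSuboperad K M).carrier n))

end Finiteness

theorem mainTheorem2_general (K : Type u) [Field K] (M : Type v) [MulOneClass M] :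
    NSOperad.Suboperad.generated (cliqueOperad K M) (triangleSet K M) = ncSuboperad K M ∧
    IsQuadratic (ncRelations K M) ∧
    (∃ φ : NSOperad.Iso (ncPresented K M) (ncOperad K M),
      ∀ p : Triangle M, φ.toEquiv 1 (ncPresentedGenerator K p) = ncTriangle K p) ∧
    RewriteRule.inducedSpace K (NCRule M) = ncRelations K M ∧
    RewriteRule.Convergent (NCRule M) ∧
    ∀ n, Nonempty (Module.Basis {t : BinaryTree (Triangle M) //
      t.numLeaves = n + 1 ∧ RewriteRule.IsNormalForm (NCRule M) t} K ((ncOperad K M).obj n)) := by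
  have lift_eq (s s' : BinaryTree (Triangle M)) (h : NCRule M s s') := h.lift_eq
  have ideal_eq_ker : NSOperad.OperadIdeal.generated (freeOperad K (Triangle M))
      (ncRelations K M) = (freeOperadHom K Triangle.toClique).ker := by
    rw [← inducedSpace_ncRule]
    exact RewriteRule.generated_inducedSpace_eq_ker K terminating_ncRule lift_eq
      injOn_lift_isNormalForm
  have range_eq := freeOperadHom_toClique_range K M
  obtain ⟨φ, hφ⟩ := NSOperad.Hom.exists_iso_of_ker_of_range ideal_eq_ker range_eq.symm
  refine ⟨generated_triangleSet K M, isQuadratic_ncRelations K, ⟨φ, fun p => ?_⟩,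
    inducedSpace_ncRule K, ⟨terminating_ncRule, RewriteRule.confluent_of_injOn_lift
      terminating_ncRule lift_eq injOn_lift_isNormalForm⟩, fun n => ?_⟩
  · exact Subtype.ext ((hφ 1 _).trans (freeOperadHom_freeCorolla K _ p))
  · have := RewriteRule.exists_basis_freeOperadHom_range K terminating_ncRule lift_eq
      injOn_lift_isNormalForm n
    rwa [range_eq] at this

/-- Presentation of the operad `NC M` of noncrossing `M`-cliques of a finite unitary magma `M`. -/
theorem mainTheorem2 (K : Type*) [Field K] [CharZero K] (M : Type*) [MulOneClass M] [Finite M] :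
    -- `NC M` is the suboperad of `C M` generated by the `M`-triangles
    NSOperad.Suboperad.generated (cliqueOperad K M) (triangleSet K M) = ncSuboperad K M ∧
    -- `NC M` admits the binary and quadratic presentation by the triangles and the relations
    IsQuadratic (ncRelations K M) ∧
    (∃ φ : NSOperad.Iso (ncPresented K M) (ncOperad K M),
      ∀ p : Triangle M, φ.toEquiv 1 (ncPresentedGenerator K p) = ncTriangle K p) ∧
    -- the rewrite rule is a convergent orientation of the relations
    RewriteRule.inducedSpace K (NCRule M) = ncRelations K M ∧
    RewriteRule.Convergent (NCRule M) ∧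
    -- its normal forms are counted by the Hilbert series of `NC M`
    (∀ n, Module.Finite K ((ncOperad K M).obj n)) ∧
    (∀ n, Finite {t : BinaryTree (Triangle M) //
      t.numLeaves = n ∧ RewriteRule.IsNormalForm (NCRule M) t}) ∧
    RewriteRule.normalFormSeries (NCRule M) = (ncOperad K M).hilbertSeries := by
  obtain ⟨generated_eq, quadratic, iso, induced_eq, convergent, basis⟩ :=
    mainTheorem2_general K M
  exact ⟨generated_eq, quadratic, iso, induced_eq, convergent, inferInstance,
    RewriteRule.finite_normalForms basis, RewriteRule.normalFormSeries_eq_hilbertSeries basis⟩
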